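/- Let $\mathbb D=\{z\in\mathbb C:|z|<1\}$, $k\in[0,1]$, $p\in(0,2]$ and $m\in\mathbb N=\{1,2,\dots\}$. Let $\mathcal H_k$ be the class of harmonic mappings $f=h+\overline g$ in $\mathbb D$, where $h(z)=\sum_{n\ge0}a_nz^n$ and $g(z)=\sum_{n\ge1}b_nz^n$ are analytic in $\mathbb D$, $|h|\le1$ and $|g'|\le k|h'|$ in $\mathbb D$. For such $f$ and $0\le r<1$ put $$E_f(k,r)=\sum_{n=1}^\infty|a_n|r^n+\sum_{n=1}^\infty|b_n|r^n+\frac{1}{1+|a_0|}\cdot\frac{1+|a_0|r}{1-r}\left(\sum_{n=1}^\infty|a_n|^2r^{2n}+c(k)\sum_{n=1}^\infty|b_n|^2r^{2n}\right),$$ where $c(0)=0$ and $c(k)=1/k$ for $k\in(0,1]$, and for $z\in\mathbb D$ put $F_f^p(z)=|h(z^m)|^p+E_f(k,|z|)$. Let $f=h+\overline g\in\mathcal H_k$ with $h$ not constant, let $a=|h(0)|$, and let $q$ be the order of the zero of $h-h(0)$ at $0$. Then the equation $\lambda_{m,k}^p(a,r)=0$, where $$\lambda_{m,k}^p(a,r)=\{[(1+k)(1-a^2)+1]r-1\}(1+ar^m)^p+(1-r)(r^m+a)^p,$$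 has exactly one root $r=r_{m,k}^p(a)$ in $(0,1)$, and the following hold. (i) If $k=0$, or if $k>0$ and $|b_q|\le\frac{1}{2k|a_q|}$, then $F_f^p(z)\le1$ for all $z$ with $|z|\le r_{m,k}^p(a)$. (ii) If $k=0$, or $k=1$, or $r_{m,k}^p(a)\le1/3$, then $F_f^p(z)\le1$ for all $z$ with $|z|\le r_{m,k}^p(a)$ without any condition on $b_q$, and the radius $r_{m,k}^p(a)$ cannot be improved: there is $f_1=h_1+\overline{g_1}\in\mathcal H_k$ with $h_1$ not constant and $|h_1(0)|=a$ such that for every $r\in(r_{m,k}^p(a),1)$ there is $z$ with $|z|=r$ and $F_{f_1}^p(z)>1$. -/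

import Mathlib

open Metric Set

noncomputable section

/-- The `n`-th Taylor coefficient at `0`. -/
def taylorCoeff (f : ℂ → ℂ) (n : ℕ) : ℂ := iteratedDeriv n f 0 / (n.factorial : ℂ)

/-- `f = h + conj g` belongs to the class `H_k`. The pair `(h, g)` is determined by `f` on the
unit disk because `g 0 = 0`, so the class is described through this pair. -/
structure IsHk (k : ℝ) (h g : ℂ → ℂ) : Prop where
  analytic_h : DifferentiableOn ℂ h (ball 0 1)
  analytic_g : DifferentiableOn ℂ g (ball 0 1)
  g_zero : g 0 = 0
  norm_h_le : ∀ z ∈ ball (0 : ℂ) 1, ‖h z‖ ≤ 1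
  norm_deriv_le : ∀ z ∈ ball (0 : ℂ) 1, ‖deriv g z‖ ≤ k * ‖deriv h z‖

/-- `h` is not identically constant in the unit disk. -/
def NonconstOnDisk (h : ℂ → ℂ) : Prop := ¬ ∃ c : ℂ, ∀ z ∈ ball (0 : ℂ) 1, h z = c

/-- `‖f - f 0‖_r ^ 2 = ∑_{n ≥ 1} |a_n|² r^{2n}`. -/
def normSqR (f : ℂ → ℂ) (r : ℝ) : ℝ :=
  ∑' n : ℕ, ‖taylorCoeff f (n + 1)‖ ^ 2 * r ^ (2 * (n + 1))

/-- `∑_{n ≥ 1} |a_n| r^n`. -/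
def majorantTail (f : ℂ → ℂ) (r : ℝ) : ℝ :=
  ∑' n : ℕ, ‖taylorCoeff f (n + 1)‖ * r ^ (n + 1)

/-- The constant `c(k)`. -/
def cConst (k : ℝ) : ℝ := if k = 0 then 0 else 1 / k

/-- The quantity `E_f(k, r)` for `f = h + conj g`. -/
def bohrE (h g : ℂ → ℂ) (k r : ℝ) : ℝ :=
  majorantTail h r + majorantTail g r +
    1 / (1 + ‖h 0‖) * ((1 + ‖h 0‖ * r) / (1 - r)) * (normSqR h r + cConst k * normSqR g r)

/-- The quantity `F_f^p(z) = |h(z^m)|^p + E_f(k, |z|)`. -/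
def bohrF (h g : ℂ → ℂ) (k p : ℝ) (m : ℕ) (z : ℂ) : ℝ :=
  ‖h (z ^ m)‖ ^ p + bohrE h g k ‖z‖

/-- The function `λ_{m,k}^p(a, r)`. -/
def bohrLambda (m : ℕ) (k p a r : ℝ) : ℝ :=
  (((1 + k) * (1 - a ^ 2) + 1) * r - 1) * (1 + a * r ^ m) ^ p + (1 - r) * (r ^ m + a) ^ p

/-- The order of the zero of `h - h 0` at `0`. -/
def zeroOrder (h : ℂ → ℂ) : ℕ := analyticOrderNatAt (fun z => h z - h 0) 0

end

/-! Write a = |h(0)| and u = 1 - a². Everything rests on one estimate for the whole class: E_f(k, r)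
≤ (1 + k) u r / (1 - r) for 0 ≤ r ≤ 1/2 (`bohrE_le`). Schwarz–Pick bounds |h(z^m)| by (r^m + a) / (1
+ a r^m), so F_f^p ≤ Φ(r) with Φ = `bohrPhi`, and λ is Φ - 1 times a positive factor. Since Φ is
strictly increasing, Φ(0) = a^p < 1 and Φ(1/(2+k)) ≥ 1 (here p ≤ 2 enters), the root is unique and
at most 1/2, hence inside the range of the estimate; this settles (i) and the first half of (ii).
For h₁ = (a + z)/(1 + az) and g₁ = k(h₁ - a) one has F = Φ at z = r, which gives sharpness.

The h-part of E_f is the refined Bohr inequality `IsToeplitzContraction.refined_bohr`.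
Multiplication by a function bounded by 1 is a contraction of ℓ², also on truncations; a suitable
test vector turns this into Carlson's bounds for |a_{2l}| and |a_{2l+1}|, which telescope against
powers of r.

For the g-part write g' = kωh' with |ω| ≤ 1. As c(k)k² = k, the g-terms are k times the same
expression in the coefficients B_n of a primitive of ωh', and `bohr_dominated` bounds that by u r /
(1 - r). The contraction given by ω, followed by Abel summation, compares the square sums of B with
those of h. If r ≤ a, a weighted AM–GM finishes, with equality for the disk automorphism. If a < r ≤
1/2, then |ω_n| ≤ 1 - |ω_0|² reduces the claim to an elementary inequality, in which either the
square terms of B are smaller by enough to pay for its linear terms, or the leading coefficient of h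
is small. -/

/-! ### Bounded analytic functions as contractive Toeplitz matrices -/

/-- Multiplication by a polynomial bounded by `C` on the unit circle increases the `ℓ²` norm of the
coefficients at most by the factor `C`. -/
theorem Polynomial.sum_sq_norm_coeff_mul_le (W P : Polynomial ℂ) (N : ℕ) {C : ℝ}
    (hW : ∀ z : ℂ, ‖z‖ = 1 → ‖W.eval z‖ ≤ C) :
    ∑ n ∈ Finset.range N, ‖(W * P).coeff n‖ ^ 2 ≤ C ^ 2 * ∑ n ∈ P.support, ‖P.coeff n‖ ^ 2 := by
  have hint : ∀ Q : Polynomial ℂ, ∀ c : ℝ,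
      CircleIntegrable (fun z => c * ‖Q.eval z‖ ^ 2) 0 1 := by
    intro Q c
    apply ContinuousOn.circleIntegrable'
    exact (Continuous.continuousOn (by fun_prop))
  calc ∑ n ∈ Finset.range N, ‖(W * P).coeff n‖ ^ 2
      ≤ ∑ n ∈ (W * P).support, ‖(W * P).coeff n‖ ^ 2 := by
        rw [← Finset.sum_filter_ne_zero]
        apply Finset.sum_le_sum_of_subset_of_nonneg
        · intro n hn
          rw [Polynomial.mem_support_iff]
          rintro h
          simp [h] at hn
        · intros; positivity
    _ = Real.circleAverage (fun z ↦ 1 * ‖(W * P).eval z‖ ^ 2) 0 1 := by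
        simp only [one_mul]
        exact Polynomial.sum_sq_norm_coeff_eq_circleAverage _
    _ ≤ Real.circleAverage (fun z ↦ C ^ 2 * ‖P.eval z‖ ^ 2) 0 1 := by
        apply Real.circleAverage_mono (hint _ _) (hint _ _)
        intro z hz
        have hz1 : ‖z‖ = 1 := by simpa using hz
        have h := hW z hz1
        rw [one_mul, Polynomial.eval_mul, norm_mul, mul_pow]
        gcongr
    _ = C ^ 2 * ∑ n ∈ P.support, ‖P.coeff n‖ ^ 2 := by
        rw [Polynomial.sum_sq_norm_coeff_eq_circleAverage, ← smul_eq_mul,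
          ← Real.circleAverage_smul]
        rfl

theorem hasSum_taylorCoeff {f : ℂ → ℂ} (hf : DifferentiableOn ℂ f (ball 0 1)) {z : ℂ}
    (hz : z ∈ ball (0 : ℂ) 1) : HasSum (fun n => taylorCoeff f n * z ^ n) (f z) := by
  refine (Complex.hasSum_taylorSeries_on_ball hf hz).congr_fun ?_
  intro n
  simp only [taylorCoeff, sub_zero, smul_eq_mul]
  ring

theorem summable_norm_taylorCoeff {f : ℂ → ℂ} (hf : DifferentiableOn ℂ f (ball 0 1)) {s : ℝ}
    (hs0 : 0 ≤ s) (hs : s < 1) : Summable (fun n => ‖taylorCoeff f n‖ * s ^ n) := by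
  have h := (hasSum_taylorCoeff hf (z := (s : ℂ)) (by simpa [abs_of_nonneg hs0] using hs)).summable
  simpa [abs_of_nonneg hs0] using h.norm

/-- The lower triangular Toeplitz matrix of the Taylor coefficients of an analytic function bounded
by `1` is a contraction. -/
theorem sum_sq_norm_taylorCoeff_conv_le {f : ℂ → ℂ} (hf : DifferentiableOn ℂ f (ball 0 1))
    (hb : ∀ z ∈ ball (0 : ℂ) 1, ‖f z‖ ≤ 1) (p : ℕ → ℂ) (N : ℕ) :
    ∑ n ∈ Finset.range N, ‖∑ j ∈ Finset.range (n + 1), taylorCoeff f (n - j) * p j‖ ^ 2 ≤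
      ∑ n ∈ Finset.range N, ‖p n‖ ^ 2 := by
  -- the same bound for the dilations `z ↦ f (s z)`, up to a factor close to `1`
  have key : ∀ s : ℝ, 0 ≤ s → s < 1 → ∀ ε : ℝ, 0 < ε →
      ∑ n ∈ Finset.range N,
        ‖∑ j ∈ Finset.range (n + 1), taylorCoeff f (n - j) * (s : ℂ) ^ (n - j) * p j‖ ^ 2 ≤
      (1 + ε) ^ 2 * ∑ n ∈ Finset.range N, ‖p n‖ ^ 2 := by
    intro s hs0 hs ε hε
    have hsum := summable_norm_taylorCoeff hf hs0 hs
    obtain ⟨K, hKN, hK⟩ : ∃ K, N ≤ K ∧ ∑' i, ‖taylorCoeff f (i + K)‖ * s ^ (i + K) < ε := by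
      have h := tendsto_sum_nat_add (fun n => ‖taylorCoeff f n‖ * s ^ n)
      exact ((Filter.eventually_ge_atTop N).and (h.eventually_lt_const hε)).exists
    set W : Polynomial ℂ :=
      ∑ i ∈ Finset.range K, Polynomial.monomial i (taylorCoeff f i * (s : ℂ) ^ i) with hW
    set P : Polynomial ℂ := ∑ i ∈ Finset.range N, Polynomial.monomial i (p i) with hP
    have hWc : ∀ i < K, W.coeff i = taylorCoeff f i * (s : ℂ) ^ i := by
      intro i hi
      simp [hW, Polynomial.coeff_monomial, hi.not_ge]
    have hPc : ∀ i < N, P.coeff i = p i := by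
      intro i hi
      simp [hP, Polynomial.coeff_monomial, hi.not_ge]
    have hWle : ∀ z : ℂ, ‖z‖ = 1 → ‖W.eval z‖ ≤ 1 + ε := by
      intro z hz
      have hsz : (s : ℂ) * z ∈ ball (0 : ℂ) 1 := by
        simpa [hz, abs_of_nonneg hs0] using hs
      have hS := hasSum_taylorCoeff hf hsz
      have h1 := hS.summable.sum_add_tsum_nat_add K
      rw [hS.tsum_eq] at h1
      have h2 : W.eval z = ∑ i ∈ Finset.range K, taylorCoeff f i * ((s : ℂ) * z) ^ i := by
        simp [hW, Polynomial.eval_finsetSum, Polynomial.eval_monomial, mul_pow, mul_assoc]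
      have h3 : ‖∑' i, taylorCoeff f (i + K) * ((s : ℂ) * z) ^ (i + K)‖ ≤
          ∑' i, ‖taylorCoeff f (i + K)‖ * s ^ (i + K) := by
        apply tsum_of_norm_bounded ((summable_nat_add_iff K).2 hsum).hasSum
        intro i
        simp [hz, abs_of_nonneg hs0]
      have h4 : W.eval z = f (s * z) - ∑' i, taylorCoeff f (i + K) * ((s : ℂ) * z) ^ (i + K) := by
        rw [h2, ← h1]; ring
      rw [h4]
      refine (norm_sub_le _ _).trans (add_le_add (hb _ hsz) (h3.trans hK.le))
    have h := Polynomial.sum_sq_norm_coeff_mul_le W P N hWle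
    refine (le_of_eq ?_).trans (h.trans (mul_le_mul_of_nonneg_left ?_ (by positivity)))
    · apply Finset.sum_congr rfl
      intro n hn
      rw [mul_comm W P, Polynomial.coeff_mul, Finset.Nat.sum_antidiagonal_eq_sum_range_succ_mk]
      congr 2
      apply Finset.sum_congr rfl
      intro j hj
      have hj' := Finset.mem_range.1 hj
      have hn' := Finset.mem_range.1 hn
      rw [hWc _ (by omega), hPc _ (by omega), mul_comm]
    · calc ∑ n ∈ P.support, ‖P.coeff n‖ ^ 2 ≤ ∑ n ∈ Finset.range N, ‖P.coeff n‖ ^ 2 := by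
            apply Finset.sum_le_sum_of_subset_of_nonneg
            · intro n hn
              by_contra hnN
              refine Polynomial.mem_support_iff.1 hn ?_
              rw [hP, Polynomial.finsetSum_coeff]
              apply Finset.sum_eq_zero
              intro i hi
              rw [Polynomial.coeff_monomial, if_neg]
              rintro rfl
              exact hnN hi
            · intros; positivity
        _ = ∑ n ∈ Finset.range N, ‖p n‖ ^ 2 :=
            Finset.sum_congr rfl fun n hn => by rw [hPc n (Finset.mem_range.1 hn)]
  have key2 : ∀ s : ℝ, 0 ≤ s → s < 1 →
      ∑ n ∈ Finset.range N,
        ‖∑ j ∈ Finset.range (n + 1), taylorCoeff f (n - j) * (s : ℂ) ^ (n - j) * p j‖ ^ 2 ≤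
      ∑ n ∈ Finset.range N, ‖p n‖ ^ 2 := by
    intro s hs0 hs
    have hlim : Filter.Tendsto (fun ε : ℝ => (1 + ε) ^ 2 * ∑ n ∈ Finset.range N, ‖p n‖ ^ 2)
        (nhdsWithin 0 (Ioi 0)) (nhds ((1 + 0) ^ 2 * ∑ n ∈ Finset.range N, ‖p n‖ ^ 2)) :=
      (Continuous.tendsto (by fun_prop) 0).mono_left nhdsWithin_le_nhds
    have := ge_of_tendsto hlim (by
      filter_upwards [self_mem_nhdsWithin] with ε hε using key s hs0 hs ε hε)
    simpa using this
  have hlim : Filter.Tendsto (fun s : ℝ => ∑ n ∈ Finset.range N,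
        ‖∑ j ∈ Finset.range (n + 1), taylorCoeff f (n - j) * (s : ℂ) ^ (n - j) * p j‖ ^ 2)
      (nhdsWithin 1 (Iio 1)) (nhds (∑ n ∈ Finset.range N,
        ‖∑ j ∈ Finset.range (n + 1), taylorCoeff f (n - j) * ((1 : ℝ) : ℂ) ^ (n - j) * p j‖ ^ 2)) :=
    (Continuous.tendsto (by fun_prop) 1).mono_left nhdsWithin_le_nhds
  have := le_of_tendsto hlim (by
    filter_upwards [Ioo_mem_nhdsLT (zero_lt_one' ℝ)] with s hs using key2 s hs.1.le hs.2)
  simpa using this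

/-! ### Carlson's coefficient inequalities -/

/-- The infinite lower triangular Toeplitz matrix with symbol `A` is a contraction. -/
def IsToeplitzContraction (A : ℕ → ℂ) : Prop :=
  ∀ (p : ℕ → ℂ) (N : ℕ), ∑ n ∈ Finset.range N, ‖∑ j ∈ Finset.range (n + 1), A (n - j) * p j‖ ^ 2 ≤
      ∑ n ∈ Finset.range N, ‖p n‖ ^ 2

namespace IsToeplitzContraction

variable {A : ℕ → ℂ}

theorem sum_sq_le_one (hA : IsToeplitzContraction A) (N : ℕ) :
    ∑ n ∈ Finset.range N, ‖A n‖ ^ 2 ≤ 1 := by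
  have h := hA (Pi.single 0 1) (N + 1)
  have h1 : ∀ n, ∑ j ∈ Finset.range (n + 1), A (n - j) * (Pi.single 0 1 : ℕ → ℂ) j = A n := by
    intro n
    rw [Finset.sum_range_succ']
    simp
  have h2 : ∑ n ∈ Finset.range (N + 1), ‖(Pi.single 0 1 : ℕ → ℂ) n‖ ^ 2 = 1 := by
    rw [Finset.sum_range_succ']
    simp
  simp only [h1] at h
  rw [h2, Finset.sum_range_succ] at h
  have := sq_nonneg ‖A N‖
  linarith

/-- Prepending a zero to the symbol keeps the contraction property. -/
theorem shift (hA : IsToeplitzContraction A) :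
    IsToeplitzContraction (fun n => if n = 0 then 0 else A (n - 1)) := by
  intro p N
  cases N with
  | zero => simp
  | succ N =>
    rw [Finset.sum_range_succ', Finset.sum_range_succ _ N]
    have h := hA p N
    have h1 : ∀ n, ∑ j ∈ Finset.range (n + 1 + 1),
        (if n + 1 - j = 0 then 0 else A (n + 1 - j - 1)) * p j =
        ∑ j ∈ Finset.range (n + 1), A (n - j) * p j := by
      intro n
      rw [Finset.sum_range_succ]
      simp only [Nat.sub_self, if_true, zero_mul, add_zero]
      apply Finset.sum_congr rfl
      intro j hj
      have := Finset.mem_range.1 hj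
      rw [if_neg (by omega), show n + 1 - j - 1 = n - j by omega]
    simp only [h1]
    simp only [zero_add, Finset.sum_range_one, Nat.sub_self, if_true, zero_mul, norm_zero]
    have := sq_nonneg ‖p N‖
    linarith

/-- The contraction property tested on `e₀ + s eₗ + v ∑_{i < l} conj (A i) e_{2l-i}`. -/
theorem test_vector (hA : IsToeplitzContraction A) {l : ℕ} (hl : 1 ≤ l) (s v : ℂ) :
    ∑ i ∈ Finset.range l, ‖A i‖ ^ 2 + ‖A l + A 0 * s‖ ^ 2 +
      ‖A (2 * l) + A l * s + v * (∑ i ∈ Finset.range l, ‖A i‖ ^ 2 : ℝ)‖ ^ 2 ≤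
      1 + ‖s‖ ^ 2 + ‖v‖ ^ 2 * ∑ i ∈ Finset.range l, ‖A i‖ ^ 2 := by
  set τ : ℝ := ∑ i ∈ Finset.range l, ‖A i‖ ^ 2 with hτ
  set p : ℕ → ℂ := fun j => if j = 0 then 1 else if j < l then 0 else if j = l then s else
    v * (starRingEnd ℂ) (A (2 * l - j)) with hp
  have h := hA p (2 * l + 1)
  have hp0 : p 0 = 1 := by simp [hp]
  have hpz : ∀ j, 1 ≤ j → j < l → p j = 0 := by
    intro j h1 h2
    simp only [hp]
    rw [if_neg (by omega), if_pos h2]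
  have hps : p l = s := by
    simp only [hp]
    rw [if_neg (by omega), if_neg (by omega)]
    simp
  have hpv : ∀ i < l, p (l + 1 + i) = v * (starRingEnd ℂ) (A (l - 1 - i)) := by
    intro i hi
    simp only [hp]
    rw [if_neg (by omega), if_neg (by omega), if_neg (by omega)]
    congr 3
    omega
  -- Rows below l see only e₀, row l also sees s, and in row 2l the conjugates pair with A to give v
  -- ∑ |A i|². The rows strictly between l and 2l are discarded.
  have hrow : ∀ n, n < l → ∀ F : ℕ → ℂ,
      ∑ j ∈ Finset.range (n + 1), F j * p j = F 0 := by
    intro n hn F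
    rw [Finset.sum_range_succ', Finset.sum_eq_zero (fun j hj => ?_)]
    · simp [hp0]
    · have := Finset.mem_range.1 hj
      rw [hpz _ (by omega) (by omega), mul_zero]
  have hrow' : ∀ F : ℕ → ℂ, ∑ j ∈ Finset.range (l + 1), F j * p j = F 0 + F l * s := by
    intro F
    rw [Finset.sum_range_succ, hps]
    congr 1
    obtain ⟨n, rfl⟩ : ∃ n, l = n + 1 := ⟨l - 1, by omega⟩
    exact hrow n (by omega) F
  have hR : ∑ n ∈ Finset.range (2 * l + 1), ‖p n‖ ^ 2 = 1 + ‖s‖ ^ 2 + ‖v‖ ^ 2 * τ := by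
    have e : 2 * l + 1 = (l + 1) + l := by omega
    rw [e, Finset.sum_range_add, Finset.sum_range_succ, hps]
    congr 1
    · obtain ⟨n, rfl⟩ : ∃ n, l = n + 1 := ⟨l - 1, by omega⟩
      rw [Finset.sum_range_succ', Finset.sum_eq_zero (fun j hj => ?_), hp0]
      · simp
      · have := Finset.mem_range.1 hj
        rw [hpz _ (by omega) (by omega)]
        simp
    · rw [hτ, Finset.mul_sum, ← Finset.sum_range_reflect (fun i => ‖v‖ ^ 2 * ‖A i‖ ^ 2)]
      apply Finset.sum_congr rfl
      intro i hi
      rw [hpv i (Finset.mem_range.1 hi)]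
      simp [mul_pow]
  have hlast : ∑ j ∈ Finset.range (2 * l + 1), A (2 * l - j) * p j =
      A (2 * l) + A l * s + v * (τ : ℂ) := by
    have e : 2 * l + 1 = (l + 1) + l := by omega
    rw [e, Finset.sum_range_add, hrow' (fun j => A (2 * l - j))]
    congr 1
    · rw [Nat.sub_zero, show 2 * l - l = l by omega]
    · rw [hτ, Complex.ofReal_sum, Finset.mul_sum,
        ← Finset.sum_range_reflect (fun i => v * ((‖A i‖ ^ 2 : ℝ) : ℂ))]
      apply Finset.sum_congr rfl
      intro i hi
      rw [hpv i (Finset.mem_range.1 hi), show 2 * l - (l + 1 + i) = l - 1 - i by omega,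
        mul_left_comm, Complex.mul_conj, Complex.normSq_eq_norm_sq]
  rw [hR] at h
  refine le_trans ?_ h
  set F : ℕ → ℝ := fun n => ‖∑ j ∈ Finset.range (n + 1), A (n - j) * p j‖ ^ 2 with hF
  have hF0 : ∀ n, 0 ≤ F n := fun n => sq_nonneg _
  have hτF : τ = ∑ n ∈ Finset.range l, F n := by
    rw [hτ]
    apply Finset.sum_congr rfl
    intro i hi
    simp only [hF]
    rw [hrow i (Finset.mem_range.1 hi) (fun j => A (i - j)), Nat.sub_zero]
  have hFl : F l = ‖A l + A 0 * s‖ ^ 2 := by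
    simp only [hF]
    rw [hrow' (fun j => A (l - j)), Nat.sub_zero, Nat.sub_self]
  have hFM : F (2 * l) = ‖A (2 * l) + A l * s + v * (τ : ℂ)‖ ^ 2 := by
    simp only [hF, hlast]
  have hsub := Finset.sum_le_sum_of_subset_of_nonneg (f := F)
      (Finset.range_mono (show l + 1 ≤ 2 * l by omega)) (fun i _ _ => hF0 i)
  rw [Finset.sum_range_succ, ← hτF, hFl] at hsub
  rw [show ∑ n ∈ Finset.range (2 * l + 1), ‖∑ j ∈ Finset.range (n + 1), A (n - j) * p j‖ ^ 2 =
    ∑ n ∈ Finset.range (2 * l), F n + F (2 * l) from Finset.sum_range_succ F _, hFM]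
  linarith

/-- **Carlson's inequality** for the coefficients of even index. -/
theorem norm_even_le (hA : IsToeplitzContraction A) (h0 : ‖A 0‖ < 1) {l : ℕ} (hl : 1 ≤ l) :
    ‖A (2 * l)‖ ≤ 1 - ∑ i ∈ Finset.range l, ‖A i‖ ^ 2 - ‖A l‖ ^ 2 / (1 + ‖A 0‖) := by
  have htest := hA.test_vector hl
  set τ : ℝ := ∑ i ∈ Finset.range l, ‖A i‖ ^ 2 with hτ
  have hx0 : 0 ≤ ‖A 0‖ := norm_nonneg _
  have hsq : τ + ‖A l‖ ^ 2 + ‖A (2 * l)‖ ^ 2 ≤ 1 := by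
    have := htest 0 0
    simpa using this
  obtain ⟨δ, hδ⟩ : ∃ δ, δ = 1 - τ := ⟨_, rfl⟩
  have hδ0 : 0 ≤ δ := by nlinarith [sq_nonneg ‖A l‖, sq_nonneg ‖A (2 * l)‖]
  rcases hδ0.eq_or_lt with hδz | hδp
  · have h1 : ‖A l‖ = 0 := by
      nlinarith [sq_nonneg ‖A l‖, sq_nonneg ‖A (2 * l)‖]
    have h2 : ‖A (2 * l)‖ = 0 := by
      nlinarith [sq_nonneg ‖A l‖, sq_nonneg ‖A (2 * l)‖]
    rw [h1, h2]
    simp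
    linarith
  -- eliminate `v`
  have hs : ∀ s : ℂ, δ * ‖A l + A 0 * s‖ ^ 2 + ‖A (2 * l) + A l * s‖ ^ 2 ≤ δ ^ 2 + δ * ‖s‖ ^ 2 := by
    intro s
    have h := htest s ((A (2 * l) + A l * s) / δ)
    set Y := A (2 * l) + A l * s
    have e : Y + Y / δ * (τ : ℂ) = Y / δ := by
      have : (δ : ℂ) ≠ 0 := by exact_mod_cast hδp.ne'
      field_simp
      rw [hδ]
      push_cast
      ring
    rw [e, norm_div, Complex.norm_real, Real.norm_of_nonneg hδp.le] at h
    have h' : ‖A l + A 0 * s‖ ^ 2 + (‖Y‖ / δ) ^ 2 * δ ≤ δ + ‖s‖ ^ 2 := by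
      rw [hδ] at h ⊢
      nlinarith
    have e2 : (‖Y‖ / δ) ^ 2 * δ * δ = ‖Y‖ ^ 2 := by field_simp
    nlinarith
  obtain ⟨x, hx⟩ : ∃ x, x = ‖A 0‖ := ⟨_, rfl⟩
  obtain ⟨b, hb⟩ : ∃ b, b = ‖A l‖ := ⟨_, rfl⟩
  obtain ⟨y, hy⟩ : ∃ y, y = ‖A (2 * l)‖ := ⟨_, rfl⟩
  set κ : ℂ := δ * (A l * (starRingEnd ℂ) (A 0)) + A (2 * l) * (starRingEnd ℂ) (A l) with hκ
  obtain ⟨D, hD⟩ : ∃ D, D = δ * (1 - x ^ 2) - b ^ 2 := ⟨_, rfl⟩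
  obtain ⟨E, hE⟩ : ∃ E, E = δ ^ 2 - δ * b ^ 2 - y ^ 2 := ⟨_, rfl⟩
  -- A real quadratic inequality valid for every s forces D ≥ 0 and ‖κ‖² ≤ D E. The minimiser is s =
  -- κ / D; replacing D by D + ε covers D = 0.
  have hquad : ∀ s : ℂ, 2 * (κ * (starRingEnd ℂ) s).re ≤ ‖s‖ ^ 2 * D + E := by
    intro s
    have h := hs s
    have e1 : ∀ z : ℂ, ‖z‖ ^ 2 = z.re ^ 2 + z.im ^ 2 := by
      intro z
      rw [Complex.sq_norm, Complex.normSq_apply]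
      ring
    rw [hD, hE, hx, hb, hy]
    simp only [e1, hκ, Complex.add_re, Complex.add_im, Complex.mul_re, Complex.mul_im,
      Complex.conj_re, Complex.conj_im, Complex.ofReal_re, Complex.ofReal_im] at h ⊢
    linarith
  have hD0 : 0 ≤ D := by
    by_contra hneg
    push Not at hneg
    have h1 : ∀ t : ℝ, 0 ≤ t ^ 2 * D + E := by
      intro t
      have h1 := hquad (t : ℂ)
      have h2 := hquad (-t : ℂ)
      simp only [map_neg, Complex.conj_ofReal, norm_neg, Complex.norm_real, mul_neg,
        Complex.neg_re, Real.norm_eq_abs, sq_abs] at h1 h2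
      linarith
    have hE0 : 0 ≤ E := by simpa using h1 0
    have h2 := h1 (Real.sqrt ((E + 1) / -D))
    rw [Real.sq_sqrt (div_nonneg (by linarith) (by linarith))] at h2
    have : (E + 1) / -D * D = -(E + 1) := by
      rw [div_neg, neg_mul, div_mul_cancel₀ _ hneg.ne]
    linarith
  have hκE : ‖κ‖ ^ 2 ≤ D * E := by
    have h1 : ∀ ε : ℝ, 0 < ε → ‖κ‖ ^ 2 ≤ (D + ε) * E := by
      intro ε hε
      have h := hquad (κ / ((D + ε : ℝ) : ℂ))
      have hDε : 0 < D + ε := by linarith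
      have e1 : (κ * (starRingEnd ℂ) (κ / ((D + ε : ℝ) : ℂ))).re = ‖κ‖ ^ 2 / (D + ε) := by
        rw [map_div₀, Complex.conj_ofReal, ← mul_div_assoc, Complex.mul_conj,
          Complex.normSq_eq_norm_sq, ← Complex.ofReal_div, Complex.ofReal_re]
      rw [e1, norm_div, Complex.norm_real, Real.norm_of_nonneg hDε.le, div_pow] at h
      have h2 : ‖κ‖ ^ 2 / (D + ε) ^ 2 * D ≤ ‖κ‖ ^ 2 / (D + ε) := by
        rw [div_mul_eq_mul_div, div_le_div_iff₀ (by positivity) hDε]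
        have := sq_nonneg ‖κ‖
        nlinarith [mul_nonneg this (mul_nonneg hε.le hDε.le)]
      have h3 : ‖κ‖ ^ 2 / (D + ε) ≤ E := by linarith
      rw [div_le_iff₀ hDε] at h3
      linarith
    have hlim : Filter.Tendsto (fun ε : ℝ => (D + ε) * E) (nhdsWithin 0 (Ioi 0))
        (nhds ((D + 0) * E)) :=
      (Continuous.tendsto (by fun_prop) 0).mono_left nhdsWithin_le_nhds
    have := ge_of_tendsto hlim (by filter_upwards [self_mem_nhdsWithin] with ε hε using h1 ε hε)
    simpa using this
  have hκlow : b ^ 2 * (δ * x - y) ^ 2 ≤ ‖κ‖ ^ 2 := by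
    have h1 : |b * (δ * x - y)| ≤ ‖κ‖ := by
      have h2 := abs_norm_sub_norm_le (δ * (A l * (starRingEnd ℂ) (A 0)))
        (-(A (2 * l) * (starRingEnd ℂ) (A l)))
      rw [sub_neg_eq_add, ← hκ, norm_neg] at h2
      simp only [norm_mul, RCLike.norm_conj, Complex.norm_real, Real.norm_of_nonneg hδp.le] at h2
      rw [← hx, ← hb, ← hy] at h2
      convert h2 using 2
      ring
    have := sq_le_sq' (by linarith [abs_nonneg (b * (δ * x - y)), norm_nonneg κ]) h1
    rw [sq_abs] at this
    linarith [mul_pow b (δ * x - y) 2]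
  rw [← hx] at h0 hx0
  rw [← hx, ← hb, ← hy]
  have hx1 : 0 < 1 - x ^ 2 := by nlinarith
  -- The discriminant condition turns into a difference of two squares times δ. Its square root then
  -- contains a factor 1 - x, and removing it leaves Carlson's bound.
  have hmain : ((1 - x ^ 2) * y - x * b ^ 2) ^ 2 ≤ D ^ 2 := by
    have h1 : 0 ≤ (1 - x ^ 2) * (D * E - b ^ 2 * (δ * x - y) ^ 2) :=
      mul_nonneg hx1.le (by linarith)
    have h2 : (1 - x ^ 2) * (D * E - b ^ 2 * (δ * x - y) ^ 2) =
        δ * (D ^ 2 - ((1 - x ^ 2) * y - x * b ^ 2) ^ 2) := by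
      rw [hD, hE]
      ring
    rw [h2] at h1
    have := nonneg_of_mul_nonneg_right h1 hδp
    linarith
  have h3 := abs_le_of_sq_le_sq' hmain hD0
  have h4 : (1 - x) * (b ^ 2 + (y - δ) * (1 + x)) ≤ 0 := by
    have := h3.2
    rw [hD] at this
    nlinarith
  have h5 : b ^ 2 + (y - δ) * (1 + x) ≤ 0 := by
    by_contra h6
    push Not at h6
    nlinarith [mul_pos (sub_pos.2 h0) h6]
  have h6 : b ^ 2 / (1 + x) ≤ δ - y := by
    rw [div_le_iff₀ (by linarith)]
    nlinarith
  linarith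

/-- **Carlson's inequality** for the coefficients of odd index. -/
theorem norm_odd_le (hA : IsToeplitzContraction A) (l : ℕ) :
    ‖A (2 * l + 1)‖ ≤ 1 - ∑ i ∈ Finset.range (l + 1), ‖A i‖ ^ 2 := by
  -- For the shifted symbol the index 2l + 1 becomes 2(l + 1) and the zeroth entry is 0, so the last
  -- term is ‖A l‖² / 1, exactly the summand completing the range.
  have h := hA.shift.norm_even_le (by simp) (l := l + 1) (by omega)
  rw [Finset.sum_range_succ'] at h
  rw [Finset.sum_range_succ]
  simpa [mul_add, sub_sub] using h

theorem norm_zero_le_one (hA : IsToeplitzContraction A) : ‖A 0‖ ≤ 1 := by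
  have h := hA.sum_sq_le_one 1
  rw [Finset.sum_range_one] at h
  exact (sq_le_one_iff₀ (norm_nonneg _)).1 h

/-- Wiener's bound, here read off from Carlson's by keeping only ‖A 0‖² in the sum. -/
theorem norm_le_one_sub_sq (hA : IsToeplitzContraction A) {n : ℕ} (hn : 1 ≤ n) :
    ‖A n‖ ≤ 1 - ‖A 0‖ ^ 2 := by
  rcases hA.norm_zero_le_one.lt_or_eq with h0 | h0
  swap
  · have h1 := hA.sum_sq_le_one (n + 1)
    rw [Finset.sum_range_succ] at h1
    have h2 := Finset.single_le_sum (f := fun i => ‖A i‖ ^ 2) (fun i _ => sq_nonneg _)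
      (Finset.mem_range.2 (show 0 < n by omega))
    simp only [h0] at h2 ⊢
    nlinarith [norm_nonneg (A n)]
  have hsum : ∀ l, 1 ≤ l → ‖A 0‖ ^ 2 ≤ ∑ i ∈ Finset.range l, ‖A i‖ ^ 2 := fun l hl =>
    Finset.single_le_sum (f := fun i => ‖A i‖ ^ 2) (fun i _ => sq_nonneg _) (by simp; omega)
  rcases Nat.even_or_odd' n with ⟨l, rfl | rfl⟩
  · have h1 := hA.norm_even_le h0 (l := l) (by omega)
    have h2 := hsum l (by omega)
    have h3 : 0 ≤ ‖A l‖ ^ 2 / (1 + ‖A 0‖) := by positivity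
    linarith
  · have h1 := hA.norm_odd_le l
    have h2 := hsum (l + 1) (by omega)
    linarith

end IsToeplitzContraction

/-! ### The refined Bohr inequality -/

theorem isToeplitzContraction_taylorCoeff {f : ℂ → ℂ} (hf : DifferentiableOn ℂ f (ball 0 1))
    (hb : ∀ z ∈ ball (0 : ℂ) 1, ‖f z‖ ≤ 1) : IsToeplitzContraction (taylorCoeff f) :=
  sum_sq_norm_taylorCoeff_conv_le hf hb

/-- **Refined Bohr inequality** for coefficient sequences of analytic functions bounded by `1`. -/
theorem IsToeplitzContraction.refined_bohr {A : ℕ → ℂ} (hA : IsToeplitzContraction A)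
    (h0 : ‖A 0‖ < 1) {r : ℝ} (hr0 : 0 ≤ r) (hr1 : r < 1) (N : ℕ) :
    ∑ n ∈ Finset.range N, ‖A (n + 1)‖ * r ^ (n + 1) +
      1 / (1 + ‖A 0‖) * ((1 + ‖A 0‖ * r) / (1 - r)) *
        ∑ n ∈ Finset.range N, ‖A (n + 1)‖ ^ 2 * r ^ (2 * (n + 1)) ≤
      (1 - ‖A 0‖ ^ 2) * r / (1 - r) := by
  set a := ‖A 0‖ with ha
  have ha0 : 0 ≤ a := norm_nonneg _
  have h1r : 0 < 1 - r := by linarith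
  -- In the Carlson bounds |A_n|² is subtracted with weight 1/(1+a) in the coefficient of index 2n
  -- and with weight 1 in all later ones; the latter give the geometric tail r / (1 - r).
  have hw : 1 / (1 + a) * ((1 + a * r) / (1 - r)) = 1 / (1 + a) + r / (1 - r) := by
    field_simp
    ring
  rw [hw]
  -- The subtracted term is what the remaining coefficients could still contribute. Keeping it makes
  -- the induction telescope, each step using one even and one odd Carlson bound.
  have key : ∀ N : ℕ, ∑ n ∈ Finset.range (2 * N + 1), ‖A (n + 1)‖ * r ^ (n + 1) +
      (1 / (1 + a) + r / (1 - r)) * ∑ n ∈ Finset.range N, ‖A (n + 1)‖ ^ 2 * r ^ (2 * (n + 1)) ≤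
      (1 - a ^ 2) * r / (1 - r) - r ^ (2 * N + 2) / (1 - r) *
        (1 - ∑ n ∈ Finset.range (N + 1), ‖A n‖ ^ 2) := by
    intro N
    induction N with
    | zero =>
      have h := hA.norm_odd_le 0
      simp only [mul_zero, zero_add, Finset.sum_range_one, Finset.sum_range_zero, add_zero] at h ⊢
      rw [← ha] at h ⊢
      have e : (1 - a ^ 2) * r / (1 - r) - r ^ 2 / (1 - r) * (1 - a ^ 2) = (1 - a ^ 2) * r := by
        field_simp
      rw [e, pow_one]
      exact mul_le_mul_of_nonneg_right h hr0
    | succ N ih =>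
      have he := hA.norm_even_le h0 (l := N + 1) (by omega)
      have ho := hA.norm_odd_le (N + 1)
      rw [Finset.sum_range_succ _ (N + 1)] at ho ⊢
      rw [show 2 * (N + 1) + 1 = 2 * N + 1 + 1 + 1 by ring, Finset.sum_range_succ _ (2 * N + 1 + 1),
        Finset.sum_range_succ _ (2 * N + 1), Finset.sum_range_succ _ N]
      rw [show 2 * (N + 1) + 1 = 2 * N + 1 + 1 + 1 by ring] at ho
      rw [show 2 * (N + 1) = 2 * N + 1 + 1 by ring] at he
      rw [show 2 * (N + 1) = 2 * N + 2 by ring]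
      set σ := ∑ n ∈ Finset.range (N + 1), ‖A n‖ ^ 2
      set X := ‖A (N + 1)‖ ^ 2
      set R := r ^ (2 * N + 2) with hR
      have hR0 : 0 ≤ R := pow_nonneg hr0 _
      have e2 : r ^ (2 * N + 1 + 1 + 1) = R * r := by rw [hR]; ring
      have e3 : r ^ (2 * N + 2 + 2) = R * r ^ 2 := by rw [hR]; ring
      rw [e2, e3]
      rw [← ha] at he
      have h1 := mul_le_mul_of_nonneg_right he hR0
      have h2 := mul_le_mul_of_nonneg_right ho (mul_nonneg hR0 hr0)
      have h3 : (1 - σ - X / (1 + a)) * R + (1 - (σ + X)) * (R * r) +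
          (1 / (1 + a) + r / (1 - r)) * (X * R) =
          R / (1 - r) * (1 - σ) - R * r ^ 2 / (1 - r) * (1 - (σ + X)) := by
        have : 1 + a ≠ 0 := by positivity
        field_simp
        ring
      linarith
  have hsig := hA.sum_sq_le_one (N + 1)
  have hk := key N
  have hmono : ∑ n ∈ Finset.range N, ‖A (n + 1)‖ * r ^ (n + 1) ≤
      ∑ n ∈ Finset.range (2 * N + 1), ‖A (n + 1)‖ * r ^ (n + 1) :=
    Finset.sum_le_sum_of_subset_of_nonneg (Finset.range_mono (by omega))
      (fun i _ _ => by positivity)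
  have hpos : 0 ≤ r ^ (2 * N + 2) / (1 - r) * (1 - ∑ n ∈ Finset.range (N + 1), ‖A n‖ ^ 2) :=
    mul_nonneg (by positivity) (by linarith)
  linarith

/-! ### Abel summation and weighted square sums -/

/-- Summation by parts: nonnegative partial sums stay nonnegative under antitone weights. -/
theorem sum_mul_nonneg_of_antitone {d μ : ℕ → ℝ} (hd : ∀ n, 0 ≤ ∑ i ∈ Finset.range n, d i)
    (hμ : Antitone μ) (hμ0 : ∀ n, 0 ≤ μ n) (N : ℕ) : 0 ≤ ∑ i ∈ Finset.range N, d i * μ i := by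
  have key : ∀ n, μ n * ∑ i ∈ Finset.range (n + 1), d i ≤ ∑ i ∈ Finset.range (n + 1), d i * μ i := by
    intro n
    induction n with
    | zero => simp [mul_comm]
    | succ n ih =>
      rw [Finset.sum_range_succ, Finset.sum_range_succ _ (n + 1), mul_add]
      have h1 := mul_le_mul_of_nonneg_right (hμ (Nat.le_succ n)) (hd (n + 1))
      have : μ (n + 1) * d (n + 1) = d (n + 1) * μ (n + 1) := mul_comm _ _
      simp only [Nat.succ_eq_add_one] at h1
      linarith
  cases N with
  | zero => simp
  | succ n => exact (mul_nonneg (hμ0 n) (hd (n + 1))).trans (key n)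

theorem sum_mul_le_sum_mul_of_antitone {x y μ : ℕ → ℝ}
    (h : ∀ n, ∑ i ∈ Finset.range n, y i ≤ ∑ i ∈ Finset.range n, x i)
    (hμ : Antitone μ) (hμ0 : ∀ n, 0 ≤ μ n) (N : ℕ) :
    ∑ i ∈ Finset.range N, y i * μ i ≤ ∑ i ∈ Finset.range N, x i * μ i := by
  have := sum_mul_nonneg_of_antitone (d := fun i => x i - y i)
    (fun n => by rw [Finset.sum_sub_distrib]; linarith [h n]) hμ hμ0 N
  simp only [sub_mul, Finset.sum_sub_distrib] at this
  linarith

/-- Lowering the first weight from μ 0 to μ 1 keeps the weights antitone; the part removed there is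
the surplus on the left. -/
theorem sum_mul_add_le_sum_mul_of_antitone {x y μ : ℕ → ℝ}
    (h : ∀ n, ∑ i ∈ Finset.range n, y i ≤ ∑ i ∈ Finset.range n, x i)
    (hμ : Antitone μ) (hμ0 : ∀ n, 0 ≤ μ n) (N : ℕ) :
    ∑ i ∈ Finset.range (N + 1), y i * μ i + (x 0 - y 0) * (μ 0 - μ 1) ≤
      ∑ i ∈ Finset.range (N + 1), x i * μ i := by
  have := sum_mul_le_sum_mul_of_antitone (μ := fun i => if i = 0 then μ 1 else μ i) h ?_ ?_ (N + 1)
  · rw [Finset.sum_range_succ', Finset.sum_range_succ'] at this ⊢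
    simp only [Nat.add_eq_zero_iff, one_ne_zero, and_false, if_false, if_true] at this
    linarith
  · intro i j hij
    dsimp only
    split_ifs with h1 h2 h2
    · rfl
    · omega
    · exact hμ (by omega)
    · exact hμ hij
  · intro n
    split_ifs
    · exact hμ0 1
    · exact hμ0 n

theorem sum_pow_succ_le {r : ℝ} (hr0 : 0 ≤ r) (hr1 : r < 1) (N : ℕ) :
    ∑ n ∈ Finset.range N, r ^ (n + 1) ≤ r / (1 - r) := by
  have h := geom_sum_mul_neg r N
  have h1 : ∑ n ∈ Finset.range N, r ^ (n + 1) = r * ∑ n ∈ Finset.range N, r ^ n := by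
    rw [Finset.mul_sum]
    exact Finset.sum_congr rfl fun n _ => by ring
  rw [h1, le_div_iff₀ (by linarith), mul_assoc, h]
  nlinarith [mul_nonneg hr0 (pow_nonneg hr0 N)]

/-- If partial sums of `x n ^ 2` obey the bound valid for functions with `|h| ≤ 1`, `|h 0| = a`,
then so do the power-weighted sums. -/
theorem sum_sq_mul_pow_le {x : ℕ → ℝ} {a ρ : ℝ} (ha0 : 0 ≤ a) (ha1 : a < 1)
    (hx : ∀ N, ∑ n ∈ Finset.range N, x (n + 1) ^ 2 + x 0 ^ 2 ≤
      (1 - a ^ 2) ^ 2 + a ^ 2 * ∑ n ∈ Finset.range N, x n ^ 2)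
    (hρ0 : 0 ≤ ρ) (hρ1 : ρ ≤ 1) (N : ℕ) :
    ∑ n ∈ Finset.range N, x n ^ 2 * ρ ^ (n + 1) ≤ ρ * (1 - a ^ 2) ^ 2 / (1 - a ^ 2 * ρ) := by
  have ha2 : a ^ 2 < 1 := by nlinarith
  have hden : 0 < 1 - a ^ 2 * ρ := by nlinarith [sq_nonneg a]
  -- The hypothesis compares x² with a² times its own shift. With weights ρ^n this becomes S ≤ (1 -
  -- a²)² + a²ρS, to be solved for S.
  set e : ℕ → ℝ := fun n => if n = 0 then (1 - a ^ 2) ^ 2 else a ^ 2 * x (n - 1) ^ 2 with he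
  have hanti : Antitone fun n : ℕ => ρ ^ n := pow_right_anti₀ hρ0 hρ1
  have hsum : ∀ n, ∑ i ∈ Finset.range n, x i ^ 2 ≤ ∑ i ∈ Finset.range n, e i := by
    intro n
    cases n with
    | zero => simp
    | succ n =>
      rw [Finset.sum_range_succ', Finset.sum_range_succ' e]
      have : ∑ k ∈ Finset.range n, e (k + 1) = a ^ 2 * ∑ k ∈ Finset.range n, x k ^ 2 := by
        rw [Finset.mul_sum]
        exact Finset.sum_congr rfl fun k _ => by simp [he]
      rw [this]
      have h0 : e 0 = (1 - a ^ 2) ^ 2 := by simp [he]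
      rw [h0]
      linarith [hx n]
  have h1 := sum_mul_le_sum_mul_of_antitone hsum hanti (fun n => pow_nonneg hρ0 n) (N + 1)
  rw [Finset.sum_range_succ' (fun i => e i * ρ ^ i)] at h1
  have h2 : ∑ k ∈ Finset.range N, e (k + 1) * ρ ^ (k + 1) =
      a ^ 2 * ∑ n ∈ Finset.range N, x n ^ 2 * ρ ^ (n + 1) := by
    rw [Finset.mul_sum]
    exact Finset.sum_congr rfl fun k _ => by simp [he]; ring
  rw [h2] at h1
  have h3 : e 0 * ρ ^ 0 = (1 - a ^ 2) ^ 2 := by simp [he]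
  rw [h3, Finset.sum_range_succ] at h1
  have h4 : ∑ n ∈ Finset.range N, x n ^ 2 * ρ ^ (n + 1) =
      ρ * ∑ n ∈ Finset.range N, x n ^ 2 * ρ ^ n := by
    rw [Finset.mul_sum]
    exact Finset.sum_congr rfl fun k _ => by ring
  rw [le_div_iff₀ hden]
  have h5 : 0 ≤ x N ^ 2 * ρ ^ N := by positivity
  nlinarith

theorem antitone_pow_div_sq {ρ : ℝ} (hρ0 : 0 ≤ ρ) (hρ1 : ρ ≤ 1) :
    Antitone fun n : ℕ => ρ ^ (n + 1) / ((n : ℝ) + 1) ^ 2 := by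
  apply antitone_nat_of_succ_le
  intro n
  push_cast
  apply div_le_div₀ (by positivity) (pow_le_pow_of_le_one hρ0 hρ1 (by omega)) (by positivity)
  gcongr
  linarith

/-- Square sums of derivatives pass to the functions because the weights ρ^(n+1)/(n+1)², which
cancel the factors from differentiation, are still antitone. -/
theorem sum_sq_mul_pow_le_of_sum_deriv_sq_le {x b : ℕ → ℝ}
    (hbx : ∀ N, ∑ n ∈ Finset.range N, (((n : ℝ) + 1) * b n) ^ 2 ≤
      ∑ n ∈ Finset.range N, (((n : ℝ) + 1) * x n) ^ 2)
    {ρ : ℝ} (hρ0 : 0 ≤ ρ) (hρ1 : ρ ≤ 1) (N : ℕ) :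
    ∑ n ∈ Finset.range N, b n ^ 2 * ρ ^ (n + 1) ≤ ∑ n ∈ Finset.range N, x n ^ 2 * ρ ^ (n + 1) := by
  have h := sum_mul_le_sum_mul_of_antitone hbx (antitone_pow_div_sq hρ0 hρ1)
    (fun n => by positivity) N
  have e : ∀ y : ℕ → ℝ, ∑ n ∈ Finset.range N,
      (((n : ℝ) + 1) * y n) ^ 2 * (ρ ^ (n + 1) / ((n : ℝ) + 1) ^ 2) =
      ∑ n ∈ Finset.range N, y n ^ 2 * ρ ^ (n + 1) := by
    intro y
    apply Finset.sum_congr rfl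
    intro n _
    have : (n : ℝ) + 1 ≠ 0 := by positivity
    field_simp
  rwa [e, e] at h

/-- Here ρ - ρ²/4 is the drop between the first two weights ρ^(n+1)/(n+1)². The surplus is what a
dilatation with |ω(0)| < 1 gains in the first coefficient. -/
theorem sum_sq_mul_pow_add_le_of_sum_deriv_sq_le {x b : ℕ → ℝ}
    (hbx : ∀ N, ∑ n ∈ Finset.range N, (((n : ℝ) + 1) * b n) ^ 2 ≤
      ∑ n ∈ Finset.range N, (((n : ℝ) + 1) * x n) ^ 2)
    {ρ : ℝ} (hρ0 : 0 ≤ ρ) (hρ1 : ρ ≤ 1) (N : ℕ) :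
    ∑ n ∈ Finset.range (N + 1), b n ^ 2 * ρ ^ (n + 1) + (x 0 ^ 2 - b 0 ^ 2) * (ρ - ρ ^ 2 / 4) ≤
      ∑ n ∈ Finset.range (N + 1), x n ^ 2 * ρ ^ (n + 1) := by
  have h := sum_mul_add_le_sum_mul_of_antitone hbx (antitone_pow_div_sq hρ0 hρ1)
    (fun n => by positivity) N
  have e : ∀ y : ℕ → ℝ, ∑ n ∈ Finset.range (N + 1),
      (((n : ℝ) + 1) * y n) ^ 2 * (ρ ^ (n + 1) / ((n : ℝ) + 1) ^ 2) =
      ∑ n ∈ Finset.range (N + 1), y n ^ 2 * ρ ^ (n + 1) := by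
    intro y
    apply Finset.sum_congr rfl
    intro n _
    have : (n : ℝ) + 1 ≠ 0 := by positivity
    field_simp
  rw [e, e] at h
  norm_num at h
  exact h

/-! ### The majorant of a function with dominated derivative -/

/-- The Bohr type inequality for a function whose derivative is dominated by that of `h`, at radii
`r ≤ |h 0|`. -/
theorem bohr_dominated_of_le {x b : ℕ → ℝ} {a r : ℝ} (ha1 : a < 1)
    (hx : ∀ N, ∑ n ∈ Finset.range N, x (n + 1) ^ 2 + x 0 ^ 2 ≤
      (1 - a ^ 2) ^ 2 + a ^ 2 * ∑ n ∈ Finset.range N, x n ^ 2)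
    (hbx : ∀ N, ∑ n ∈ Finset.range N, (((n : ℝ) + 1) * b n) ^ 2 ≤
      ∑ n ∈ Finset.range N, (((n : ℝ) + 1) * x n) ^ 2)
    (hr0 : 0 < r) (hra : r ≤ a) (N : ℕ) :
    ∑ n ∈ Finset.range N, b n * r ^ (n + 1) + 1 / (1 + a) * ((1 + a * r) / (1 - r)) *
        ∑ n ∈ Finset.range N, b n ^ 2 * r ^ (2 * (n + 1)) ≤ (1 - a ^ 2) * r / (1 - r) := by
  have ha0 : 0 < a := by linarith
  have hr1 : 0 < 1 - r := by linarith
  have har : 0 < 1 - a * r := by nlinarith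
  obtain ⟨u, hu⟩ : ∃ u, u = 1 - a ^ 2 := ⟨_, rfl⟩
  have hu0 : 0 < u := by rw [hu]; nlinarith
  have hsq : ∑ n ∈ Finset.range N, b n ^ 2 * r ^ (2 * (n + 1)) ≤
      r ^ 2 * u ^ 2 / (1 - a ^ 2 * r ^ 2) := by
    have h1 := sum_sq_mul_pow_le_of_sum_deriv_sq_le hbx (sq_nonneg r) (by nlinarith) N
    have h2 := sum_sq_mul_pow_le ha0.le ha1 hx (sq_nonneg r) (by nlinarith) N
    simp only [pow_mul]
    rw [hu]
    exact h1.trans h2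
  -- The only use of r ≤ a is to make r / a an admissible antitone weight.
  have hρ1 : r / a ≤ 1 := (div_le_one ha0).2 hra
  have hlin : ∑ n ∈ Finset.range N, b n * r ^ (n + 1) ≤ u * r / (1 - a * r) := by
    have h1 := sum_sq_mul_pow_le_of_sum_deriv_sq_le hbx (div_nonneg hr0.le ha0.le) hρ1 N
    have h2 := sum_sq_mul_pow_le ha0.le ha1 hx (div_nonneg hr0.le ha0.le) hρ1 N
    have h3 := sum_pow_succ_le (r := a * r) (by positivity) (by linarith) N
    -- AM–GM balanced at b n = u a^n, the coefficients of the disk automorphism, so that nothing is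
    -- lost in the extremal case.
    have h4 : ∑ n ∈ Finset.range N, b n * r ^ (n + 1) ≤
        a / u / 2 * ∑ n ∈ Finset.range N, b n ^ 2 * (r / a) ^ (n + 1) +
          u / a / 2 * ∑ n ∈ Finset.range N, (a * r) ^ (n + 1) := by
      rw [Finset.mul_sum, Finset.mul_sum, ← Finset.sum_add_distrib]
      apply Finset.sum_le_sum
      intro n _
      rw [div_pow, mul_pow]
      have hα : 0 < a ^ (n + 1) := by positivity
      have hs : 0 < r ^ (n + 1) := by positivity
      set α := a ^ (n + 1)
      set s := r ^ (n + 1)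
      have h5 : a / u / 2 * (b n ^ 2 * (s / α)) + u / a / 2 * (α * s) - b n * s =
          s * (a / (u * α)) / 2 * (b n - u * α / a) ^ 2 := by
        field_simp
        ring
      have h6 : 0 ≤ s * (a / (u * α)) / 2 * (b n - u * α / a) ^ 2 := by positivity
      linarith
    have h7 : a / u / 2 * ∑ n ∈ Finset.range N, b n ^ 2 * (r / a) ^ (n + 1) ≤
        a / u / 2 * (r / a * (1 - a ^ 2) ^ 2 / (1 - a ^ 2 * (r / a))) :=
      mul_le_mul_of_nonneg_left (h1.trans h2) (by positivity)
    have h8 := mul_le_mul_of_nonneg_left h3 (show 0 ≤ u / a / 2 by positivity)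
    have e1 : a / u / 2 * (r / a * (1 - a ^ 2) ^ 2 / (1 - a ^ 2 * (r / a))) =
        u * r / (1 - a * r) / 2 := by
      rw [← hu, show a ^ 2 * (r / a) = a * r by field_simp]
      field_simp
    have e2 : u / a / 2 * (a * r / (1 - a * r)) = u * r / (1 - a * r) / 2 := by
      field_simp
    linarith
  have hw0 : 0 ≤ 1 / (1 + a) * ((1 + a * r) / (1 - r)) := by positivity
  have h9 := mul_le_mul_of_nonneg_left hsq hw0
  have e3 : u * r / (1 - a * r) + 1 / (1 + a) * ((1 + a * r) / (1 - r)) *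
      (r ^ 2 * u ^ 2 / (1 - a ^ 2 * r ^ 2)) = u * r / (1 - r) := by
    have : 1 - a ^ 2 * r ^ 2 = (1 - a * r) * (1 + a * r) := by ring
    rw [this]
    have h10 : 1 + a * r ≠ 0 := by positivity
    obtain ⟨e, he⟩ : ∃ e, e = 1 - a * r := ⟨_, rfl⟩
    have h11 : e ≠ 0 := he ▸ har.ne'
    rw [← he]
    field_simp
    rw [hu, he]
    ring
  rw [← hu]
  linarith

theorem sum_pow_mul_sum_range_eq {r : ℝ} (hr1 : r < 1) (z : ℕ → ℝ) (N : ℕ) :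
    ∑ n ∈ Finset.range N, r ^ (n + 1) * ∑ j ∈ Finset.range n, z j +
      r ^ (N + 1) / (1 - r) * ∑ j ∈ Finset.range N, z j =
      ∑ j ∈ Finset.range N, z j * (r ^ (j + 2) / (1 - r)) := by
  have : 1 - r ≠ 0 := by linarith
  induction N with
  | zero => simp
  | succ N ih =>
    rw [Finset.sum_range_succ, Finset.sum_range_succ _ N, Finset.sum_range_succ _ N, ← ih]
    field_simp
    ring

set_option maxHeartbeats 1000000 in
/-- The numerical part of the Bohr type inequality at radii `|h 0| < r ≤ 1 / 2`. Here `α` and `c` stand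
for the moduli of the leading coefficients of `h - h 0` and of the dilatation. -/
theorem bohr_dominated_numeric {a r α c t q w MG QG Qh u : ℝ} (ha0 : 0 ≤ a) (har : a < r)
    (hr : r ≤ 1 / 2) (hα0 : 0 ≤ α) (hc0 : 0 ≤ c) (hc1 : c ≤ 1) (ht0 : 0 ≤ t)
    (hu : u = 1 - a ^ 2) (hw0 : 0 ≤ w) (hw : w * ((1 + a) * (1 - r)) = 1 + a * r)
    (hMG : MG ≤ c * (α * r + t) + (1 - c ^ 2) * (α * r / 2 + t))
    (hQG : QG + (α ^ 2 - (c * α) ^ 2) * (r ^ 2 - (r ^ 2) ^ 2 / 4) ≤ Qh)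
    (hQh : Qh ≤ α ^ 2 * r ^ 2 + r ^ 4 * q)
    (ht : t ^ 2 * (1 - r ^ 2) ≤ q * r ^ 4) (hq : α ^ 2 + q ≤ u)
    (hS : α * r + t + w * Qh ≤ u * r / (1 - r)) : MG + w * QG ≤ u * r / (1 - r) := by
  have hr0 : 0 < r := by linarith
  have h1r : 0 < 1 - r := by linarith
  have hr2 : 0 < 1 - r ^ 2 := by nlinarith
  have hur : 1 - r ^ 2 ≤ u := by rw [hu]; nlinarith
  have hu0 : 0 < u := by linarith
  have hc2 : 0 ≤ 1 - c ^ 2 := by nlinarith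
  have hrq : r ^ 2 ≤ 1 / 4 := by nlinarith
  have hr4 : (r ^ 2) ^ 2 / 4 ≤ r ^ 2 / 16 := by
    have := mul_le_mul_of_nonneg_left hrq (sq_nonneg r)
    linarith
  have hα2 : 0 ≤ α ^ 2 - (c * α) ^ 2 := by
    have : α ^ 2 - (c * α) ^ 2 = α ^ 2 * (1 - c ^ 2) := by ring
    rw [this]
    positivity
  -- The majorant of the dominated function can exceed that of h by at most c(1-c)t. The gain in the
  -- square terms is at least 15/16 (1-c²) w α² r², with 15/16 coming from r ≤ 1/2. As 2c ≤ 1 + c,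
  -- it suffices in the first case.
  by_cases hA : t ≤ 15 / 8 * (w * α ^ 2 * r ^ 2)
  · have h1 : QG + (α ^ 2 - (c * α) ^ 2) * (15 / 16 * r ^ 2) ≤ Qh := by
      have := mul_le_mul_of_nonneg_left (show 15 / 16 * r ^ 2 ≤ r ^ 2 - (r ^ 2) ^ 2 / 4 by linarith)
        hα2
      linarith
    have h2 := mul_le_mul_of_nonneg_left h1 hw0
    set B := w * α ^ 2 * r ^ 2 with hB
    have hB0 : 0 ≤ B := by positivity
    have h3 : w * ((α ^ 2 - (c * α) ^ 2) * (15 / 16 * r ^ 2)) = 15 / 16 * (1 - c ^ 2) * B := by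
      rw [hB]; ring
    have h4 : (1 - c) * c * t ≤ (1 - c) * c * (15 / 8 * B) :=
      mul_le_mul_of_nonneg_left hA (mul_nonneg (by linarith) hc0)
    have h5 : 0 ≤ (1 - c) ^ 2 * B := by positivity
    have h6 : 0 ≤ (1 - c) ^ 2 * (α * r) := by positivity
    linarith
  · push Not at hA
    -- A large tail forces a small leading coefficient: a < r gives u w² (1 - r²) ≥ 1, and (15/8)² ·
    -- 0.42² > 0.58 yields the contradiction.
    have hα42 : α ^ 2 ≤ 42 / 100 * u := by
      by_contra hneg
      push Not at hneg
      have h1 : 1 ≤ u * w ^ 2 * (1 - r ^ 2) := by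
        have h2 : ((1 + a) * (1 - r)) ^ 2 ≤ u * (1 - r ^ 2) := by
          have : u * (1 - r ^ 2) - ((1 + a) * (1 - r)) ^ 2 = (1 + a) * (1 - r) * (2 * (r - a)) := by
            rw [hu]; ring
          have : 0 ≤ (1 + a) * (1 - r) * (2 * (r - a)) := by
            apply mul_nonneg <;> [apply mul_nonneg; skip] <;> linarith
          linarith
        have h3 := mul_le_mul_of_nonneg_left h2 (sq_nonneg w)
        rw [← mul_pow, hw] at h3
        nlinarith [mul_nonneg ha0 hr0.le]
      have h4 : (15 / 8 * (w * α ^ 2 * r ^ 2)) ^ 2 * (1 - r ^ 2) ≤ q * r ^ 4 := by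
        refine le_trans (mul_le_mul_of_nonneg_right (pow_le_pow_left₀ (by positivity) hA.le 2)
          hr2.le) ht
      have h5 : q * r ^ 4 ≤ 58 / 100 * u * r ^ 4 :=
        mul_le_mul_of_nonneg_right (by linarith) (by positivity)
      have h6 : (42 / 100 * u) ^ 2 ≤ (α ^ 2) ^ 2 := pow_le_pow_left₀ (by positivity) hneg.le 2
      have h7 : (225 / 64 * (w ^ 2 * r ^ 4 * (1 - r ^ 2))) * (42 / 100 * u) ^ 2 ≤
          (225 / 64 * (w ^ 2 * r ^ 4 * (1 - r ^ 2))) * (α ^ 2) ^ 2 :=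
        mul_le_mul_of_nonneg_left h6 (by positivity)
      have h8 : u * r ^ 4 * 1 ≤ u * r ^ 4 * (u * w ^ 2 * (1 - r ^ 2)) :=
        mul_le_mul_of_nonneg_left h1 (by positivity)
      have h9 : 0 < u * r ^ 4 := by positivity
      linarith
    -- 5/4 is the maximum of c + 1 - c², attained at c = 1/2.
    have h1 : MG ≤ α * r + 5 / 4 * t := by
      have h2 : 0 ≤ (1 - c) ^ 2 * (α * r) := by positivity
      have h3 : 0 ≤ (c - 1 / 2) ^ 2 * t := by positivity
      linarith
    have h2 : QG ≤ r ^ 2 * u * (42 / 100 + 58 / 100 * r ^ 2) := by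
      have h3 : 0 ≤ (α ^ 2 - (c * α) ^ 2) * (r ^ 2 - (r ^ 2) ^ 2 / 4) :=
        mul_nonneg hα2 (by linarith [sq_nonneg r])
      have h4 : r ^ 4 * q ≤ r ^ 4 * (u - α ^ 2) :=
        mul_le_mul_of_nonneg_left (by linarith) (by positivity)
      have h5 : r ^ 2 * (1 - r ^ 2) * α ^ 2 ≤ r ^ 2 * (1 - r ^ 2) * (42 / 100 * u) :=
        mul_le_mul_of_nonneg_left hα42 (by positivity)
      linarith
    have hw1 : w * (1 - r) ≤ 1 := by
      have h3 : w * (1 - r) * (1 + a) ≤ 1 * (1 + a) := by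
        have h4 : w * (1 - r) * (1 + a) = 1 + a * r := by rw [← hw]; ring
        have h5 : a * r ≤ a * 1 := mul_le_mul_of_nonneg_left (by linarith) ha0
        linarith
      exact le_of_mul_le_mul_right h3 (by linarith)
    set X := α * r + 5 / 4 * t with hX
    have hX0 : 0 ≤ X := by positivity
    -- u r K is what remains of u r once the square terms have been bounded; Cauchy–Schwarz then
    -- controls X.
    set K := 1 - 42 / 100 * r - 58 / 100 * r ^ 3 with hK
    have hXsq : X ^ 2 * (1 - r ^ 2) ≤ r ^ 2 * u * (1 + 9 / 16 * r ^ 2) := by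
      have h3 : r ^ 2 * (X ^ 2 * (1 - r ^ 2)) ≤
          r ^ 2 * (r ^ 2 * (α ^ 2 + q) * (1 + 9 / 16 * r ^ 2)) := by
        have h4 := mul_le_mul_of_nonneg_right ht (show 0 ≤ 1 + 9 / 16 * r ^ 2 by positivity)
        have h5 := sq_nonneg (5 / 4 * α * r ^ 3 - t * (1 - r ^ 2))
        rw [hX]
        linarith
      have h4 := le_of_mul_le_mul_left h3 (by positivity)
      have h5 : r ^ 2 * (α ^ 2 + q) * (1 + 9 / 16 * r ^ 2) ≤ r ^ 2 * u * (1 + 9 / 16 * r ^ 2) := by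
        gcongr
      linarith
    have hpoly : 1 + 9 / 32 * r ^ 2 ≤ (1 + r) * K := by
      rw [hK]
      have : 0 ≤ r * (58 / 100 - 70125 / 100000 * r - 58 / 100 * r ^ 2 - 58 / 100 * r ^ 3) := by
        apply mul_nonneg hr0.le
        have h4 : r ^ 2 * r ≤ 1 / 4 * (1 / 2) := mul_le_mul hrq hr hr0.le (by norm_num)
        have h5 : r ^ 2 * r = r ^ 3 := by ring
        linarith
      linarith
    have hK0 : 0 ≤ K := by
      have : 0 < (1 + r) * K := by linarith [sq_nonneg r]
      exact (pos_of_mul_pos_right this (by linarith)).le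
    have hXK : (1 - r) * X ≤ u * r * K := by
      refine (sq_le_sq₀ (by positivity) (by positivity)).1 ?_
      have h3 : (1 + 9 / 32 * r ^ 2) ^ 2 ≤ ((1 + r) * K) ^ 2 := pow_le_pow_left₀ (by positivity) hpoly 2
      have h4 : 1 + 9 / 16 * r ^ 2 ≤ ((1 + r) * K) ^ 2 := by linarith [sq_nonneg (r ^ 2)]
      have h5 : ((1 - r) * X) ^ 2 * (1 - r ^ 2) ≤ (u * r * K) ^ 2 * (1 - r ^ 2) := by
        calc ((1 - r) * X) ^ 2 * (1 - r ^ 2) = (1 - r) ^ 2 * (X ^ 2 * (1 - r ^ 2)) := by ring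
          _ ≤ (1 - r) ^ 2 * (r ^ 2 * u * (1 + 9 / 16 * r ^ 2)) := by gcongr
          _ ≤ (1 - r) ^ 2 * (r ^ 2 * u * ((1 + r) * K) ^ 2) := by gcongr
          _ = r ^ 2 * u * K ^ 2 * (1 - r ^ 2) * (1 - r ^ 2) := by ring
          _ ≤ r ^ 2 * u * K ^ 2 * u * (1 - r ^ 2) := by gcongr
          _ = (u * r * K) ^ 2 * (1 - r ^ 2) := by ring
      exact le_of_mul_le_mul_right h5 hr2
    rw [le_div_iff₀ h1r]
    have h3 : w * QG * (1 - r) ≤ r ^ 2 * u * (42 / 100 + 58 / 100 * r ^ 2) := by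
      have h4 : 0 ≤ r ^ 2 * u * (42 / 100 + 58 / 100 * r ^ 2) := by positivity
      have h5 := mul_le_mul_of_nonneg_left h2 (mul_nonneg hw0 h1r.le)
      have h6 := mul_le_mul_of_nonneg_right hw1 h4
      linarith
    have h4 := mul_le_mul_of_nonneg_right h1 h1r.le
    rw [hK] at hXK
    linarith

/-- The Bohr type inequality for a function whose derivative is dominated by that of `h`, at radii
`|h 0| < r ≤ 1 / 2`. -/
theorem bohr_dominated_of_lt {x b : ℕ → ℝ} {a r c : ℝ} (ha0 : 0 ≤ a) (har : a < r) (hr : r ≤ 1 / 2)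
    (hc0 : 0 ≤ c) (hc1 : c ≤ 1) (hx0 : ∀ n, 0 ≤ x n)
    (hx : ∀ N, ∑ n ∈ Finset.range N, x n ^ 2 ≤ 1 - a ^ 2)
    (hb0 : b 0 = c * x 0)
    (hb : ∀ n, b n ≤ c * x n +
      (1 - c ^ 2) * ∑ j ∈ Finset.range n, ((j : ℝ) + 1) / ((n : ℝ) + 1) * x j)
    (hbx : ∀ N, ∑ n ∈ Finset.range N, (((n : ℝ) + 1) * b n) ^ 2 ≤
      ∑ n ∈ Finset.range N, (((n : ℝ) + 1) * x n) ^ 2)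
    (hS : ∀ N, ∑ n ∈ Finset.range N, x n * r ^ (n + 1) + 1 / (1 + a) * ((1 + a * r) / (1 - r)) *
        ∑ n ∈ Finset.range N, x n ^ 2 * r ^ (2 * (n + 1)) ≤ (1 - a ^ 2) * r / (1 - r)) (N : ℕ) :
    ∑ n ∈ Finset.range N, b n * r ^ (n + 1) + 1 / (1 + a) * ((1 + a * r) / (1 - r)) *
        ∑ n ∈ Finset.range N, b n ^ 2 * r ^ (2 * (n + 1)) ≤ (1 - a ^ 2) * r / (1 - r) := by
  have hr0 : 0 < r := by linarith
  have h1r : 0 < 1 - r := by linarith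
  have hc2 : 0 ≤ 1 - c ^ 2 := by nlinarith
  have hr2 : r ^ 2 < 1 := by nlinarith
  cases N with
  | zero => simpa using hS 0
  | succ N =>
    have hNS := hS (N + 1)
    set w := 1 / (1 + a) * ((1 + a * r) / (1 - r)) with hw
    have hsplit : ∑ n ∈ Finset.range (N + 1), x n * r ^ (n + 1) =
        x 0 * r + ∑ n ∈ Finset.range N, x (n + 1) * r ^ (n + 2) := by
      rw [Finset.sum_range_succ']
      ring
    have hQG := sum_sq_mul_pow_add_le_of_sum_deriv_sq_le hbx (sq_nonneg r) hr2.le N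
    simp only [← pow_mul] at hQG
    rw [hsplit] at hNS
    have hxN := hx (N + 1)
    rw [Finset.sum_range_succ'] at hxN
    refine bohr_dominated_numeric (α := x 0) (c := c)
      (t := ∑ n ∈ Finset.range N, x (n + 1) * r ^ (n + 2))
      (q := ∑ n ∈ Finset.range N, x (n + 1) ^ 2) ha0 har hr (hx0 0) hc0 hc1
      (Finset.sum_nonneg fun n _ => mul_nonneg (hx0 _) (by positivity)) rfl ?_ ?_ ?_ ?_ ?_ ?_ ?_ hNS
    · positivity
    · rw [hw]
      field_simp
    -- For j < n the factor (j+1)/(n+1) is at most 1/2 when j = 0 and at most 1 otherwise.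
    -- Interchanging the sums produces r / (1 - r), which is at most 1 because r ≤ 1/2.
    · set z : ℕ → ℝ := fun j => if j = 0 then x 0 / 2 else x j with hz
      have hz0 : ∀ j, 0 ≤ z j := by
        intro j
        simp only [hz]
        split_ifs
        · linarith [hx0 0]
        · exact hx0 j
      have h1 : ∀ n, b n ≤ c * x n + (1 - c ^ 2) * ∑ j ∈ Finset.range n, z j := by
        intro n
        refine (hb n).trans (add_le_add le_rfl (mul_le_mul_of_nonneg_left ?_ hc2))
        apply Finset.sum_le_sum
        intro j hj
        have hjn : (j : ℝ) + 1 ≤ n := by exact_mod_cast Finset.mem_range.1 hj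
        simp only [hz]
        split_ifs with hj0
        · subst hj0
          have : ((0 : ℕ) + 1 : ℝ) / ((n : ℝ) + 1) ≤ 1 / 2 := by
            rw [div_le_div_iff₀ (by linarith) (by norm_num)]
            push_cast at hjn ⊢
            linarith
          have := mul_le_mul_of_nonneg_right this (hx0 0)
          linarith
        · have : ((j : ℝ) + 1) / ((n : ℝ) + 1) ≤ 1 :=
            (div_le_one (by positivity)).2 (by linarith)
          have := mul_le_mul_of_nonneg_right this (hx0 j)
          linarith
      have h2 : ∑ n ∈ Finset.range (N + 1), r ^ (n + 1) * ∑ j ∈ Finset.range n, z j ≤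
          x 0 * r / 2 + ∑ n ∈ Finset.range N, x (n + 1) * r ^ (n + 2) := by
        have h3 := sum_pow_mul_sum_range_eq (r := r) (by linarith) z (N + 1)
        have h4 : 0 ≤ r ^ (N + 1 + 1) / (1 - r) * ∑ j ∈ Finset.range (N + 1), z j :=
          mul_nonneg (by positivity) (Finset.sum_nonneg fun j _ => hz0 j)
        have h5 : ∑ j ∈ Finset.range (N + 1), z j * (r ^ (j + 2) / (1 - r)) ≤
            ∑ j ∈ Finset.range (N + 1), z j * r ^ (j + 1) := by
          apply Finset.sum_le_sum
          intro j _
          apply mul_le_mul_of_nonneg_left _ (hz0 j)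
          rw [div_le_iff₀ h1r, pow_succ r (j + 1)]
          exact mul_le_mul_of_nonneg_left (by linarith) (by positivity)
        have h6 : ∑ j ∈ Finset.range (N + 1), z j * r ^ (j + 1) =
            x 0 * r / 2 + ∑ n ∈ Finset.range N, x (n + 1) * r ^ (n + 2) := by
          rw [Finset.sum_range_succ']
          simp [hz]
          ring
        linarith
      calc ∑ n ∈ Finset.range (N + 1), b n * r ^ (n + 1)
          ≤ ∑ n ∈ Finset.range (N + 1),
              (c * x n + (1 - c ^ 2) * ∑ j ∈ Finset.range n, z j) * r ^ (n + 1) :=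
            Finset.sum_le_sum fun n _ => mul_le_mul_of_nonneg_right (h1 n) (by positivity)
        _ = c * ∑ n ∈ Finset.range (N + 1), x n * r ^ (n + 1) + (1 - c ^ 2) *
              ∑ n ∈ Finset.range (N + 1), r ^ (n + 1) * ∑ j ∈ Finset.range n, z j := by
            rw [Finset.mul_sum, Finset.mul_sum, ← Finset.sum_add_distrib]
            exact Finset.sum_congr rfl fun n _ => by ring
        _ ≤ _ := by
            rw [hsplit]
            have := mul_le_mul_of_nonneg_left h2 hc2
            linarith
    · rw [hb0] at hQG
      convert hQG using 3
      ring
    · rw [Finset.sum_range_succ', Finset.mul_sum, add_comm]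
      apply add_le_add
      · simp
      · apply Finset.sum_le_sum
        intro n _
        rw [mul_comm]
        apply mul_le_mul_of_nonneg_right _ (sq_nonneg _)
        exact pow_le_pow_of_le_one hr0.le (by linarith) (by omega)
    · have h1 := Finset.sum_mul_sq_le_sq_mul_sq (Finset.range N) (fun n => x (n + 1))
        (fun n => r ^ (n + 2))
      have h2 : ∑ n ∈ Finset.range N, (r ^ (n + 2)) ^ 2 ≤ r ^ 4 / (1 - r ^ 2) := by
        have h3 := sum_pow_succ_le (sq_nonneg r) hr2 N
        have h4 : ∑ n ∈ Finset.range N, (r ^ (n + 2)) ^ 2 =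
            r ^ 2 * ∑ n ∈ Finset.range N, (r ^ 2) ^ (n + 1) := by
          rw [Finset.mul_sum]
          exact Finset.sum_congr rfl fun n _ => by ring
        rw [h4]
        have h5 := mul_le_mul_of_nonneg_left h3 (sq_nonneg r)
        have h6 : r ^ 2 * (r ^ 2 / (1 - r ^ 2)) = r ^ 4 / (1 - r ^ 2) := by ring
        linarith
      have h7 : (∑ n ∈ Finset.range N, x (n + 1) * r ^ (n + 2)) ^ 2 ≤
          (∑ n ∈ Finset.range N, x (n + 1) ^ 2) * (r ^ 4 / (1 - r ^ 2)) :=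
        h1.trans (mul_le_mul_of_nonneg_left h2 (Finset.sum_nonneg fun n _ => sq_nonneg _))
      rwa [← mul_div_assoc, le_div_iff₀ (by linarith)] at h7
    · linarith

/-! ### Taylor coefficients under algebraic operations -/

theorem taylorCoeff_congr {f g : ℂ → ℂ} (h : ∀ z ∈ ball (0 : ℂ) 1, f z = g z) (n : ℕ) :
    taylorCoeff f n = taylorCoeff g n := by
  have : f =ᶠ[nhds 0] g := by
    filter_upwards [ball_mem_nhds (0 : ℂ) one_pos] with z hz using h z hz
  rw [taylorCoeff, taylorCoeff, this.iteratedDeriv_eq]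

theorem taylorCoeff_zero (f : ℂ → ℂ) : taylorCoeff f 0 = f 0 := by
  simp [taylorCoeff]

theorem taylorCoeff_deriv (f : ℂ → ℂ) (n : ℕ) :
    taylorCoeff (deriv f) n = (n + 1) * taylorCoeff f (n + 1) := by
  rw [taylorCoeff, taylorCoeff, iteratedDeriv_succ', Nat.factorial_succ]
  have h1 : (n.factorial : ℂ) ≠ 0 := by exact_mod_cast n.factorial_ne_zero
  have h2 : (n + 1 : ℂ) ≠ 0 := by exact_mod_cast n.succ_ne_zero
  push_cast
  field_simp

theorem DifferentiableOn.analyticAt_of_mem_unitBall {f : ℂ → ℂ}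
    (hf : DifferentiableOn ℂ f (ball 0 1)) {z : ℂ} (hz : z ∈ ball (0 : ℂ) 1) : AnalyticAt ℂ f z :=
  hf.analyticAt (isOpen_ball.mem_nhds hz)

theorem taylorCoeff_mul {f g : ℂ → ℂ} (hf : AnalyticAt ℂ f 0) (hg : AnalyticAt ℂ g 0) (n : ℕ) :
    taylorCoeff (fun z => f z * g z) n =
      ∑ j ∈ Finset.range (n + 1), taylorCoeff f (n - j) * taylorCoeff g j := by
  rw [taylorCoeff, iteratedDeriv_fun_mul hf.contDiffAt hg.contDiffAt, ← Finset.sum_range_reflect,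
    Finset.sum_div]
  apply Finset.sum_congr rfl
  intro j hj
  have hj' : j ≤ n := by have := Finset.mem_range.1 hj; omega
  rw [show n + 1 - 1 - j = n - j by omega, Nat.sub_sub_self hj', taylorCoeff, taylorCoeff,
    Nat.choose_symm hj']
  have h1 : (j.factorial : ℂ) ≠ 0 := by exact_mod_cast j.factorial_ne_zero
  have h2 : ((n - j).factorial : ℂ) ≠ 0 := by exact_mod_cast (n - j).factorial_ne_zero
  have h3 : (n.factorial : ℂ) ≠ 0 := by exact_mod_cast n.factorial_ne_zero
  have h4 : (n.choose j : ℂ) * j.factorial * (n - j).factorial = n.factorial := by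
    exact_mod_cast Nat.choose_mul_factorial_mul_factorial hj'
  rw [div_mul_div_comm, div_eq_div_iff h3 (mul_ne_zero h2 h1), ← h4]
  ring

theorem taylorCoeff_const_mul {f : ℂ → ℂ} (c : ℂ) (n : ℕ) :
    taylorCoeff (fun z => c * f z) n = c * taylorCoeff f n := by
  rw [taylorCoeff, taylorCoeff, iteratedDeriv_const_mul_field, mul_div_assoc]

theorem taylorCoeff_id_mul {f : ℂ → ℂ} (hf : AnalyticAt ℂ f 0) (n : ℕ) :
    taylorCoeff (fun z => z * f z) (n + 1) = taylorCoeff f n := by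
  have hid : ∀ m, taylorCoeff (fun z => z) m = if m = 1 then 1 else 0 := by
    intro m
    rw [taylorCoeff, iteratedDeriv_fun_id_zero]
    split_ifs with h
    · simp [h]
    · simp
  rw [taylorCoeff_mul (f := fun z => z) analyticAt_id hf, Finset.sum_eq_single n]
  · rw [hid, if_pos (by omega), one_mul]
  · intro j _ hj
    rw [hid, if_neg (by omega), zero_mul]
  · simp

theorem taylorCoeff_const_sub_succ {f : ℂ → ℂ} (c : ℂ) (n : ℕ) :
    taylorCoeff (fun z => c - f z) (n + 1) = -taylorCoeff f (n + 1) := by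
  rw [taylorCoeff, taylorCoeff, iteratedDeriv_succ', iteratedDeriv_succ', ← neg_div]
  congr 1
  have : deriv (fun z => c - f z) = fun z => -deriv f z := by
    ext z
    simp
  rw [this, iteratedDeriv_fun_neg]

theorem taylorCoeff_sub_const_succ {f : ℂ → ℂ} (c : ℂ) (n : ℕ) :
    taylorCoeff (fun z => f z - c) (n + 1) = taylorCoeff f (n + 1) := by
  rw [taylorCoeff, taylorCoeff, iteratedDeriv_succ', iteratedDeriv_succ']
  simp

/-! ### Schwarz–Pick and the dilatation -/

theorem norm_lt_one_of_nonconst {h : ℂ → ℂ} (hd : DifferentiableOn ℂ h (ball 0 1))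
    (hb : ∀ z ∈ ball (0 : ℂ) 1, ‖h z‖ ≤ 1) (hne : NonconstOnDisk h) {z : ℂ}
    (hz : z ∈ ball (0 : ℂ) 1) : ‖h z‖ < 1 := by
  by_contra hcon
  push Not at hcon
  refine hne ⟨h z, fun w hw => ?_⟩
  exact Complex.eqOn_of_isPreconnected_of_isMaxOn_norm (convex_ball (0 : ℂ) 1).isPreconnected
    isOpen_ball hd hz (fun y hy => (hb y hy).trans hcon) hw

theorem norm_sub_sq_le_norm_one_sub_sq {α β : ℂ} (hα : ‖α‖ ≤ 1) (hβ : ‖β‖ ≤ 1) :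
    ‖β - α‖ ^ 2 ≤ ‖1 - (starRingEnd ℂ) α * β‖ ^ 2 := by
  have e : ‖1 - (starRingEnd ℂ) α * β‖ ^ 2 - ‖β - α‖ ^ 2 = (1 - ‖α‖ ^ 2) * (1 - ‖β‖ ^ 2) := by
    simp only [Complex.sq_norm, Complex.normSq_apply, Complex.sub_re, Complex.sub_im,
      Complex.mul_re, Complex.mul_im, Complex.conj_re, Complex.conj_im, Complex.one_re,
      Complex.one_im]
    ring
  have h1 : 0 ≤ 1 - ‖α‖ ^ 2 := by nlinarith [norm_nonneg α]
  have h2 : 0 ≤ 1 - ‖β‖ ^ 2 := by nlinarith [norm_nonneg β]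
  nlinarith [mul_nonneg h1 h2]

/-- **Schwarz–Pick lemma** at the origin, in factorized form. -/
theorem exists_schwarz_pick_factor {h : ℂ → ℂ} (hd : DifferentiableOn ℂ h (ball 0 1))
    (hb : ∀ z ∈ ball (0 : ℂ) 1, ‖h z‖ ≤ 1) (h0 : ‖h 0‖ < 1) :
    ∃ U : ℂ → ℂ, DifferentiableOn ℂ U (ball 0 1) ∧ (∀ z ∈ ball (0 : ℂ) 1, ‖U z‖ ≤ 1) ∧
      ∀ z ∈ ball (0 : ℂ) 1, h z - h 0 = z * (U z * (1 - (starRingEnd ℂ) (h 0) * h z)) := by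
  have hden : ∀ z ∈ ball (0 : ℂ) 1, 1 - (starRingEnd ℂ) (h 0) * h z ≠ 0 := by
    intro z hz heq
    have h1 : ‖(starRingEnd ℂ) (h 0) * h z‖ = 1 := by
      rw [← sub_eq_zero.1 heq, norm_one]
    rw [norm_mul, RCLike.norm_conj] at h1
    nlinarith [hb z hz, norm_nonneg (h 0), norm_nonneg (h z)]
  set v : ℂ → ℂ := fun z => (h z - h 0) / (1 - (starRingEnd ℂ) (h 0) * h z) with hv
  have hvd : DifferentiableOn ℂ v (ball 0 1) :=
    (hd.sub_const _).div ((hd.const_mul _).const_sub _) hden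
  have hv0 : v 0 = 0 := by simp [hv]
  have hvb : MapsTo v (ball 0 1) (closedBall (v 0) 1) := by
    intro z hz
    rw [hv0, mem_closedBall_zero_iff]
    simp only [hv]
    rw [norm_div]
    apply div_le_one_of_le₀ _ (norm_nonneg _)
    exact (sq_le_sq₀ (norm_nonneg _) (norm_nonneg _)).1
      (norm_sub_sq_le_norm_one_sub_sq h0.le (hb z hz))
  refine ⟨dslope v 0, ?_, ?_, ?_⟩
  · exact (Complex.differentiableOn_dslope (ball_mem_nhds 0 one_pos)).2 hvd
  · intro z hz
    simpa using Complex.norm_dslope_le_div_of_mapsTo_ball hvd hvb hz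
  · intro z hz
    have h1 : z * dslope v 0 z = v z := by
      have := sub_smul_dslope v 0 z
      simpa [hv0] using this
    rw [← mul_assoc, h1]
    simp only [hv]
    rw [div_mul_cancel₀ _ (hden z hz)]

theorem norm_le_schwarz_pick {h : ℂ → ℂ} (hd : DifferentiableOn ℂ h (ball 0 1))
    (hb : ∀ z ∈ ball (0 : ℂ) 1, ‖h z‖ ≤ 1) (h0 : ‖h 0‖ < 1) {z : ℂ} (hz : z ∈ ball (0 : ℂ) 1) :
    ‖h z‖ ≤ (‖z‖ + ‖h 0‖) / (1 + ‖h 0‖ * ‖z‖) := by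
  obtain ⟨U, -, hUb, hU⟩ := exists_schwarz_pick_factor hd hb h0
  have hz1 : ‖z‖ < 1 := by simpa using hz
  have h1 : ‖h z - h 0‖ ≤ ‖z‖ * ‖1 - (starRingEnd ℂ) (h 0) * h z‖ := by
    rw [hU z hz, norm_mul, norm_mul]
    have := mul_le_mul_of_nonneg_right (hUb z hz)
      (norm_nonneg (1 - (starRingEnd ℂ) (h 0) * h z))
    rw [one_mul] at this
    exact mul_le_mul_of_nonneg_left this (norm_nonneg z)
  have h2 := pow_le_pow_left₀ (norm_nonneg _) h1 2
  have hre : (h 0).re * (h z).re + (h 0).im * (h z).im ≤ ‖h 0‖ * ‖h z‖ := by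
    have h3 := Complex.re_le_norm ((starRingEnd ℂ) (h 0) * h z)
    rw [norm_mul, RCLike.norm_conj] at h3
    simpa using h3
  have e1 : ‖h z - h 0‖ ^ 2 = ‖h z‖ ^ 2 + ‖h 0‖ ^ 2 -
      2 * ((h 0).re * (h z).re + (h 0).im * (h z).im) := by
    simp only [Complex.sq_norm, Complex.normSq_apply, Complex.sub_re, Complex.sub_im]
    ring
  have e2 : ‖1 - (starRingEnd ℂ) (h 0) * h z‖ ^ 2 = 1 + ‖h z‖ ^ 2 * ‖h 0‖ ^ 2 -
      2 * ((h 0).re * (h z).re + (h 0).im * (h z).im) := by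
    simp only [Complex.sq_norm, Complex.normSq_apply, Complex.sub_re, Complex.sub_im,
      Complex.mul_re, Complex.mul_im, Complex.conj_re, Complex.conj_im, Complex.one_re,
      Complex.one_im]
    ring
  rw [mul_pow, e1, e2] at h2
  set a := ‖h 0‖
  set H := ‖h z‖ with hH
  set ρ := ‖z‖
  have ha : 0 ≤ a := norm_nonneg _
  have hρ : 0 ≤ ρ := norm_nonneg _
  have hH1 : H ≤ 1 := hb z hz
  have hH0 : 0 ≤ H := norm_nonneg _
  -- The cross term enters with the nonnegative factor 1 - ρ², so replacing it by its largest value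
  -- ‖h 0‖ ‖h z‖ reduces to the real case.
  have h3 : (H - a) ^ 2 ≤ (ρ * (1 - a * H)) ^ 2 := by
    have h4 : 0 ≤ 1 - ρ ^ 2 := by nlinarith
    have h5 := mul_le_mul_of_nonneg_left hre h4
    nlinarith
  have h6 := (abs_le_of_sq_le_sq' h3 (mul_nonneg hρ (by nlinarith))).2
  rw [le_div_iff₀ (by positivity)]
  linarith

/-- In h - h(0) = z U (1 - conj(h(0)) h) multiplication by U is a contraction, and the last factor
has constant term 1 - |h(0)|² and higher coefficients -conj(h(0)) a_n. -/
theorem sum_sq_taylorCoeff_succ_le {h : ℂ → ℂ} (hd : DifferentiableOn ℂ h (ball 0 1))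
    (hb : ∀ z ∈ ball (0 : ℂ) 1, ‖h z‖ ≤ 1) (h0 : ‖h 0‖ < 1) (N : ℕ) :
    ∑ n ∈ Finset.range N, ‖taylorCoeff h (n + 1 + 1)‖ ^ 2 + ‖taylorCoeff h (0 + 1)‖ ^ 2 ≤
      (1 - ‖h 0‖ ^ 2) ^ 2 + ‖h 0‖ ^ 2 * ∑ n ∈ Finset.range N, ‖taylorCoeff h (n + 1)‖ ^ 2 := by
  obtain ⟨U, hUd, hUb, hU⟩ := exists_schwarz_pick_factor hd hb h0
  have hmem : (0 : ℂ) ∈ ball (0 : ℂ) 1 := mem_ball_self one_pos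
  set e : ℂ → ℂ := fun z => 1 - (starRingEnd ℂ) (h 0) * h z with he
  have hed : DifferentiableOn ℂ e (ball 0 1) := (hd.const_mul _).const_sub _
  have hUa := hUd.analyticAt_of_mem_unitBall hmem
  have hea := hed.analyticAt_of_mem_unitBall hmem
  have hcoef : ∀ n, taylorCoeff h (n + 1) =
      ∑ j ∈ Finset.range (n + 1), taylorCoeff U (n - j) * taylorCoeff e j := by
    intro n
    rw [← taylorCoeff_sub_const_succ (h 0), taylorCoeff_congr hU,
      taylorCoeff_id_mul (f := fun z => U z * e z) (hUa.mul hea), taylorCoeff_mul hUa hea]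
  have h1 := isToeplitzContraction_taylorCoeff hUd hUb (taylorCoeff e) (N + 1)
  simp only [← hcoef] at h1
  rw [Finset.sum_range_succ', Finset.sum_range_succ' (fun n => ‖taylorCoeff e n‖ ^ 2)] at h1
  have h2 : ∀ n, ‖taylorCoeff e (n + 1)‖ ^ 2 = ‖h 0‖ ^ 2 * ‖taylorCoeff h (n + 1)‖ ^ 2 := by
    intro n
    rw [he, taylorCoeff_const_sub_succ, taylorCoeff_const_mul, norm_neg, norm_mul,
      RCLike.norm_conj, mul_pow]
  have h3 : ‖taylorCoeff e 0‖ ^ 2 = (1 - ‖h 0‖ ^ 2) ^ 2 := by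
    rw [taylorCoeff_zero]
    simp only [he]
    rw [mul_comm, Complex.mul_conj, Complex.normSq_eq_norm_sq, ← Complex.ofReal_one,
      ← Complex.ofReal_sub, Complex.norm_real, Real.norm_eq_abs, sq_abs]
  simp only [h2] at h1
  rw [h3, ← Finset.mul_sum] at h1
  linarith

/-- If `|g'| ≤ k |h'|` then `g' = k ω h'` with an analytic `ω` bounded by `1`. -/
theorem exists_dilatation {k : ℝ} {h g : ℂ → ℂ} (hf : IsHk k h g) (hk : 0 ≤ k) :
    ∃ ω : ℂ → ℂ, DifferentiableOn ℂ ω (ball 0 1) ∧ (∀ z ∈ ball (0 : ℂ) 1, ‖ω z‖ ≤ 1) ∧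
      ∀ z ∈ ball (0 : ℂ) 1, deriv g z = k * (ω z * deriv h z) := by
  rcases hk.eq_or_lt with rfl | hk
  · refine ⟨fun _ => 0, differentiableOn_const _, by simp, fun z hz => ?_⟩
    have := hf.norm_deriv_le z hz
    rw [zero_mul] at this
    simpa using this
  set φ : ℂ → ℂ := fun z => deriv g z / (k * deriv h z) with hφ
  have hk0 : (k : ℂ) ≠ 0 := by exact_mod_cast hk.ne'
  have hga : ∀ z ∈ ball (0 : ℂ) 1, AnalyticAt ℂ (deriv g) z := fun z hz =>
    (hf.analytic_g.analyticAt_of_mem_unitBall hz).deriv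
  have hha : ∀ z ∈ ball (0 : ℂ) 1, AnalyticAt ℂ (deriv h) z := fun z hz =>
    (hf.analytic_h.analyticAt_of_mem_unitBall hz).deriv
  have hφm : MeromorphicOn φ (ball 0 1) := fun z hz =>
    (hga z hz).meromorphicAt.div (analyticAt_const.mul (hha z hz)).meromorphicAt
  have hφb : ∀ z ∈ ball (0 : ℂ) 1, ‖φ z‖ ≤ 1 := by
    intro z hz
    simp only [hφ]
    rw [norm_div, norm_mul, Complex.norm_real, Real.norm_of_nonneg hk.le]
    exact div_le_one_of_le₀ (hf.norm_deriv_le z hz) (by positivity)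
  have hφe : ∀ z ∈ ball (0 : ℂ) 1, deriv g z = k * (φ z * deriv h z) := by
    intro z hz
    simp only [hφ]
    by_cases hz0 : deriv h z = 0
    · have := hf.norm_deriv_le z hz
      rw [hz0, norm_zero, mul_zero] at this
      rw [hz0, norm_le_zero_iff.1 this]
      simp
    · field_simp
  -- The quotient takes the default value 0 at zeros of h'. Being bounded it has no poles, so its
  -- normal form is analytic and agrees with it off a discrete set; continuity carries the bound and
  -- the identity over.
  set ω := toMeromorphicNFOn φ (ball 0 1) with hω
  have hball : ∀ z ∈ ball (0 : ℂ) 1, ∀ᶠ w in nhdsWithin z {z}ᶜ, w ∈ ball (0 : ℂ) 1 := fun z hz =>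
    mem_nhdsWithin_of_mem_nhds (isOpen_ball.mem_nhds hz)
  have hωφ : ∀ z ∈ ball (0 : ℂ) 1, φ =ᶠ[nhdsWithin z {z}ᶜ] ω := fun z hz =>
    (hφm.toMeromorphicNFOn_eq_self_on_nhdsNE hz).symm
  have hωa : ∀ z ∈ ball (0 : ℂ) 1, AnalyticAt ℂ ω z := by
    intro z hz
    have hnf := meromorphicNFOn_toMeromorphicNFOn (f := φ) (U := ball 0 1) hz
    rw [← hnf.meromorphicOrderAt_nonneg_iff_analyticAt,
      meromorphicOrderAt_toMeromorphicNFOn hφm hz]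
    by_contra hneg
    push Not at hneg
    have h1 := tendsto_cobounded_of_meromorphicOrderAt_neg hneg
    have h2 := (tendsto_norm_cobounded_atTop.comp h1).eventually_gt_atTop 1
    obtain ⟨w, hw1, hw2⟩ := (h2.and (hball z hz)).exists
    exact absurd (hφb w hw2) (not_le.2 hw1)
  refine ⟨ω, fun z hz => (hωa z hz).differentiableAt.differentiableWithinAt, fun z hz => ?_,
    fun z hz => ?_⟩
  · have h1 := ((hωa z hz).continuousAt.norm.tendsto).mono_left
      (nhdsWithin_le_nhds (s := ({z}ᶜ : Set ℂ)))
    refine le_of_tendsto h1 ?_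
    filter_upwards [hωφ z hz, hball z hz] with w hw1 hw2
    rw [← hw1]
    exact hφb w hw2
  · have h1 := ((hga z hz).continuousAt.tendsto).mono_left
      (nhdsWithin_le_nhds (s := ({z}ᶜ : Set ℂ)))
    have h2 : Filter.Tendsto (fun w => (k : ℂ) * (ω w * deriv h w)) (nhdsWithin z {z}ᶜ)
        (nhds ((k : ℂ) * (ω z * deriv h z))) :=
      (tendsto_const_nhds.mul ((hωa z hz).continuousAt.tendsto.mul
        (hha z hz).continuousAt.tendsto)).mono_left nhdsWithin_le_nhds
    refine tendsto_nhds_unique_of_eventuallyEq h1 h2 ?_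
    filter_upwards [hωφ z hz, hball z hz] with w hw1 hw2
    rw [← hw1]
    exact hφe w hw2

/-! ### The estimate of E_f -/

/-- The uniform bound also yields summability of both series, which is needed since `tsum` is 0
otherwise; w > 0 serves the second one. -/
theorem tsum_add_mul_tsum_le {f e : ℕ → ℝ} (hf : ∀ n, 0 ≤ f n) (he : ∀ n, 0 ≤ e n) {w T : ℝ}
    (hw : 0 < w) (h : ∀ N, ∑ n ∈ Finset.range N, f n + w * ∑ n ∈ Finset.range N, e n ≤ T) :
    ∑' n, f n + w * ∑' n, e n ≤ T := by
  have hf' : ∀ N, 0 ≤ ∑ n ∈ Finset.range N, f n := fun N => Finset.sum_nonneg fun n _ => hf n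
  have he' : ∀ N, 0 ≤ ∑ n ∈ Finset.range N, e n := fun N => Finset.sum_nonneg fun n _ => he n
  have hfs : Summable f := summable_of_sum_range_le hf (c := T) fun N => by
    have := h N
    have := mul_nonneg hw.le (he' N)
    linarith
  have hes : Summable e := summable_of_sum_range_le he (c := T / w) fun N => by
    rw [le_div_iff₀ hw]
    have := h N
    have := hf' N
    linarith
  exact le_of_tendsto' (hfs.hasSum.tendsto_sum_nat.add
    (hes.hasSum.tendsto_sum_nat.const_mul w)) h

theorem IsToeplitzContraction.sum_sq_succ_le {A : ℕ → ℂ} (hA : IsToeplitzContraction A) (N : ℕ) :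
    ∑ n ∈ Finset.range N, ‖A (n + 1)‖ ^ 2 ≤ 1 - ‖A 0‖ ^ 2 := by
  have h := hA.sum_sq_le_one (N + 1)
  rw [Finset.sum_range_succ'] at h
  linarith

/-- The estimate of the majorant of `g` for `|g'| ≤ |h'|`, in terms of the Taylor coefficients of `h`
and of the dilatation `ω`. -/
theorem bohr_dominated {A Ω : ℕ → ℂ} (hA : IsToeplitzContraction A) (hΩ : IsToeplitzContraction Ω)
    (h0 : ‖A 0‖ < 1)
    (hA' : ∀ N, ∑ n ∈ Finset.range N, ‖A (n + 1 + 1)‖ ^ 2 + ‖A (0 + 1)‖ ^ 2 ≤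
      (1 - ‖A 0‖ ^ 2) ^ 2 + ‖A 0‖ ^ 2 * ∑ n ∈ Finset.range N, ‖A (n + 1)‖ ^ 2)
    {B : ℕ → ℂ} (hB : ∀ n : ℕ, (n + 1) * B n =
      ∑ j ∈ Finset.range (n + 1), Ω (n - j) * ((j + 1) * A (j + 1)))
    {r : ℝ} (hr0 : 0 ≤ r) (hr : r ≤ 1 / 2) (N : ℕ) :
    ∑ n ∈ Finset.range N, ‖B n‖ * r ^ (n + 1) +
      1 / (1 + ‖A 0‖) * ((1 + ‖A 0‖ * r) / (1 - r)) *
        ∑ n ∈ Finset.range N, ‖B n‖ ^ 2 * r ^ (2 * (n + 1)) ≤ (1 - ‖A 0‖ ^ 2) * r / (1 - r) := by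
  have hcast : ∀ n : ℕ, ‖(n : ℂ) + 1‖ = (n : ℝ) + 1 := fun n => by
    rw [← Nat.cast_succ, Complex.norm_natCast, Nat.cast_succ]
  have hBA : ∀ N, ∑ n ∈ Finset.range N, (((n : ℝ) + 1) * ‖B n‖) ^ 2 ≤
      ∑ n ∈ Finset.range N, (((n : ℝ) + 1) * ‖A (n + 1)‖) ^ 2 := by
    intro N
    have h := hΩ (fun j => (j + 1) * A (j + 1)) N
    simpa only [← hB, norm_mul, hcast] using h
  rcases le_or_gt r ‖A 0‖ with hra | hra
  · rcases hr0.eq_or_lt with rfl | hr0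
    · simp
    · exact bohr_dominated_of_le h0 hA' hBA hr0 hra N
  · refine bohr_dominated_of_lt (x := fun n => ‖A (n + 1)‖) (norm_nonneg _) hra hr
      (norm_nonneg (Ω 0)) hΩ.norm_zero_le_one (fun n => norm_nonneg _) hA.sum_sq_succ_le ?_ ?_ hBA
      (hA.refined_bohr h0 hr0 (by linarith)) N
    · have h := hB 0
      simp only [CharP.cast_eq_zero, zero_add, one_mul, Finset.sum_range_one, Nat.sub_self] at h
      rw [h, norm_mul]
    · intro n
      have hn : 0 < (n : ℝ) + 1 := by positivity
      have h1 : ((n : ℝ) + 1) * ‖B n‖ ≤ ((n : ℝ) + 1) * (‖Ω 0‖ * ‖A (n + 1)‖) +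
          (1 - ‖Ω 0‖ ^ 2) * ∑ j ∈ Finset.range n, ((j : ℝ) + 1) * ‖A (j + 1)‖ := by
        rw [← hcast, ← norm_mul, hB, Finset.sum_range_succ, add_comm, Nat.sub_self, Finset.mul_sum]
        refine (norm_add_le _ _).trans (add_le_add (le_of_eq ?_) ?_)
        · rw [norm_mul, norm_mul]
          ring
        · refine (norm_sum_le _ _).trans (Finset.sum_le_sum fun j hj => ?_)
          rw [norm_mul, norm_mul, hcast]
          refine mul_le_mul_of_nonneg_right (hΩ.norm_le_one_sub_sq ?_) (by positivity)
          have := Finset.mem_range.1 hj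
          omega
      have h2 : ∑ j ∈ Finset.range n, ((j : ℝ) + 1) / ((n : ℝ) + 1) * ‖A (j + 1)‖ =
          (∑ j ∈ Finset.range n, ((j : ℝ) + 1) * ‖A (j + 1)‖) / ((n : ℝ) + 1) := by
        rw [Finset.sum_div]
        exact Finset.sum_congr rfl fun j _ => by ring
      rw [h2]
      refine le_of_mul_le_mul_left (h1.trans (le_of_eq ?_)) hn
      field_simp

/-- This is why c(k) = 1/k: with b_n = k B_n the linear and the quadratic terms of g both scale by
k. -/
theorem cConst_mul_sq (k : ℝ) : cConst k * k ^ 2 = k := by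
  rw [cConst]
  split_ifs with h
  · simp [h]
  · field_simp

/-- `E_f(k, r) ≤ (1 + k) (1 - |h 0|²) r / (1 - r)` for `r ≤ 1 / 2`. -/
theorem bohrE_le {k : ℝ} {h g : ℂ → ℂ} (hk : 0 ≤ k) (hf : IsHk k h g) (h0 : ‖h 0‖ < 1) {r : ℝ}
    (hr0 : 0 ≤ r) (hr : r ≤ 1 / 2) :
    bohrE h g k r ≤ (1 + k) * (1 - ‖h 0‖ ^ 2) * r / (1 - r) := by
  obtain ⟨ω, hωd, hωb, hω⟩ := exists_dilatation hf hk
  have hmem : (0 : ℂ) ∈ ball (0 : ℂ) 1 := mem_ball_self one_pos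
  have hA := isToeplitzContraction_taylorCoeff hf.analytic_h hf.norm_h_le
  have hΩ := isToeplitzContraction_taylorCoeff hωd hωb
  have hωa := hωd.analyticAt_of_mem_unitBall hmem
  have hha := (hf.analytic_h.analyticAt_of_mem_unitBall hmem).deriv
  set B : ℕ → ℂ := fun n => (∑ j ∈ Finset.range (n + 1),
    taylorCoeff ω (n - j) * ((j + 1) * taylorCoeff h (j + 1))) / (n + 1) with hBdef
  have hn0 : ∀ n : ℕ, (n + 1 : ℂ) ≠ 0 := fun n => by exact_mod_cast n.succ_ne_zero
  have hB : ∀ n : ℕ, (n + 1) * B n = ∑ j ∈ Finset.range (n + 1),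
      taylorCoeff ω (n - j) * ((j + 1) * taylorCoeff h (j + 1)) := fun n => by
    simp only [hBdef]
    rw [mul_div_cancel₀ _ (hn0 n)]
  have hgB : ∀ n, taylorCoeff g (n + 1) = k * B n := by
    intro n
    apply mul_left_cancel₀ (hn0 n)
    rw [← taylorCoeff_deriv, taylorCoeff_congr hω, taylorCoeff_const_mul,
      taylorCoeff_mul hωa hha, mul_left_comm, hB]
    simp only [taylorCoeff_deriv]
  have h1r : 0 < 1 - r := by linarith
  have hgn : ∀ n, ‖taylorCoeff g (n + 1)‖ = k * ‖B n‖ := fun n => by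
    rw [hgB, norm_mul, Complex.norm_real, Real.norm_of_nonneg hk]
  have hw : 0 < 1 / (1 + ‖h 0‖) * ((1 + ‖h 0‖ * r) / (1 - r)) := by positivity
  have hS := hA.refined_bohr (by rwa [taylorCoeff_zero]) hr0 (by linarith)
  have hG := bohr_dominated hA hΩ (by rwa [taylorCoeff_zero])
    (by rw [taylorCoeff_zero]; exact sum_sq_taylorCoeff_succ_le hf.analytic_h hf.norm_h_le h0)
    hB hr0 hr
  rw [taylorCoeff_zero] at hS hG
  have hS' := tsum_add_mul_tsum_le (fun n => by positivity) (fun n => by positivity) hw hS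
  have hG' := tsum_add_mul_tsum_le (fun n => by positivity) (fun n => by positivity) hw hG
  have e1 : majorantTail g r = k * ∑' n, ‖B n‖ * r ^ (n + 1) := by
    simp only [majorantTail, hgn, mul_assoc]
    rw [tsum_mul_left]
  have e2 : normSqR g r = k ^ 2 * ∑' n, ‖B n‖ ^ 2 * r ^ (2 * (n + 1)) := by
    simp only [normSqR, hgn, mul_pow, mul_assoc]
    rw [tsum_mul_left]
  rw [bohrE, e1, e2, ← mul_assoc (cConst k), cConst_mul_sq, majorantTail, normSqR]
  have hG'' := mul_le_mul_of_nonneg_left hG' hk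
  have e3 : (1 + k) * (1 - ‖h 0‖ ^ 2) * r / (1 - r) = (1 - ‖h 0‖ ^ 2) * r / (1 - r) +
      k * ((1 - ‖h 0‖ ^ 2) * r / (1 - r)) := by ring
  rw [e3]
  linarith

/-! ### The radius as the root of Φ = 1 -/

/-- The sharp upper bound for `F_f^p` at radius `r`. -/
noncomputable def bohrPhi (m : ℕ) (k p a r : ℝ) : ℝ :=
  ((r ^ m + a) / (1 + a * r ^ m)) ^ p + (1 + k) * (1 - a ^ 2) * r / (1 - r)

theorem bohrLambda_eq {m : ℕ} {k p a r : ℝ} (ha0 : 0 ≤ a) (hr0 : 0 ≤ r) (hr1 : r < 1) :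
    bohrLambda m k p a r = (1 - r) * (1 + a * r ^ m) ^ p * (bohrPhi m k p a r - 1) := by
  have h1r : 1 - r ≠ 0 := by linarith
  have hpos : 0 < (1 + a * r ^ m) ^ p := by positivity
  rw [bohrLambda, bohrPhi, Real.div_rpow (by positivity) (by positivity)]
  field_simp
  ring

theorem bohrLambda_eq_zero_iff {m : ℕ} {k p a r : ℝ} (ha0 : 0 ≤ a) (hr0 : 0 ≤ r) (hr1 : r < 1) :
    bohrLambda m k p a r = 0 ↔ bohrPhi m k p a r = 1 := by
  have h1r : 0 < 1 - r := by linarith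
  have hpos : 0 < (1 - r) * (1 + a * r ^ m) ^ p := by positivity
  rw [bohrLambda_eq ha0 hr0 hr1, mul_eq_zero, sub_eq_zero]
  exact or_iff_right hpos.ne'

theorem add_div_one_add_mul_le {a s t : ℝ} (ha0 : 0 ≤ a) (ha1 : a < 1) (hs : 0 ≤ s) (hst : s ≤ t) :
    (s + a) / (1 + a * s) ≤ (t + a) / (1 + a * t) := by
  have ht : 0 ≤ t := hs.trans hst
  rw [div_le_div_iff₀ (by positivity) (by positivity)]
  nlinarith [mul_nonneg (sub_nonneg.2 hst) (show 0 ≤ 1 - a ^ 2 by nlinarith)]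

theorem strictMonoOn_bohrPhi {m : ℕ} {k p a : ℝ} (hk : 0 ≤ k) (hp : 0 < p) (ha0 : 0 ≤ a)
    (ha1 : a < 1) : StrictMonoOn (bohrPhi m k p a) (Ico 0 1) := by
  intro r hr s hs hrs
  have h1 : 0 < 1 - r := by linarith [hr.2]
  have h2 : 0 < 1 - s := by linarith [hs.2]
  have hr0 := hr.1
  have hu : 0 < (1 + k) * (1 - a ^ 2) := mul_pos (by linarith) (by nlinarith)
  apply add_lt_add_of_le_of_lt
  · apply Real.rpow_le_rpow (by positivity) _ hp.le
    exact add_div_one_add_mul_le ha0 ha1 (by positivity) (pow_le_pow_left₀ hr.1 hrs.le m)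
  · rw [div_lt_div_iff₀ h1 h2]
    nlinarith [mul_pos hu (sub_pos.2 hrs)]

theorem continuous_bohrLambda {m : ℕ} {k p a : ℝ} (hp : 0 < p) : Continuous (bohrLambda m k p a) := by
  unfold bohrLambda
  have h1 : Continuous fun r : ℝ => (1 + a * r ^ m) ^ p :=
    Continuous.rpow_const (by fun_prop) fun _ => Or.inr hp.le
  have h2 : Continuous fun r : ℝ => (r ^ m + a) ^ p :=
    Continuous.rpow_const (by fun_prop) fun _ => Or.inr hp.le
  fun_prop

/-- At r = 1/(2+k) one has (1+k) r / (1-r) = 1, so the second term is 1 - a², while the first is x^p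
≥ x² ≥ a² for some x in [a, 1] and p ≤ 2. -/
theorem one_le_bohrPhi {m : ℕ} {k p a : ℝ} (hk : 0 ≤ k) (hp : p ≤ 2) (ha0 : 0 ≤ a)
    (ha1 : a < 1) : 1 ≤ bohrPhi m k p a (1 / (2 + k)) := by
  have hr0 : 0 < 1 / (2 + k) := by positivity
  have hr1 : 1 / (2 + k) ≤ 1 := by
    rw [div_le_one (by linarith)]
    linarith
  set x := ((1 / (2 + k)) ^ m + a) / (1 + a * (1 / (2 + k)) ^ m) with hx
  have hs0 : 0 < (1 / (2 + k)) ^ m := by positivity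
  have hs1 : (1 / (2 + k)) ^ m ≤ 1 := pow_le_one₀ hr0.le hr1
  have hxa : a ≤ x := by
    have := add_div_one_add_mul_le ha0 ha1 le_rfl hs0.le
    rwa [zero_add, mul_zero, add_zero, div_one] at this
  have hx1 : x ≤ 1 := by
    rw [hx, div_le_one (by positivity)]
    nlinarith
  have hx0 : 0 < x := by rw [hx]; positivity
  have h1 : x ^ 2 ≤ x ^ p := by
    rw [← Real.rpow_two]
    exact Real.rpow_le_rpow_of_exponent_ge hx0 hx1 hp
  have h2 : (1 + k) * (1 - a ^ 2) * (1 / (2 + k)) / (1 - 1 / (2 + k)) = 1 - a ^ 2 := by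
    have : 1 - 1 / (2 + k) = (1 + k) / (2 + k) := by
      field_simp
      ring
    rw [this]
    field_simp
  rw [bohrPhi, h2, ← hx]
  nlinarith

theorem exists_bohr_radius {m : ℕ} {k p a : ℝ} (hm : 1 ≤ m) (hk : 0 ≤ k) (hp0 : 0 < p) (hp : p ≤ 2)
    (ha0 : 0 ≤ a) (ha1 : a < 1) :
    ∃ R ∈ Ioo (0 : ℝ) 1, R ≤ 1 / 2 ∧ bohrLambda m k p a R = 0 := by
  have hr0 : 0 < 1 / (2 + k) := by positivity
  have hr2 : 1 / (2 + k) ≤ 1 / 2 := one_div_le_one_div_of_le (by norm_num) (by linarith)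
  have hzero : bohrLambda m k p a 0 < 0 := by
    have : a ^ p < 1 := Real.rpow_lt_one ha0 ha1 hp0
    simp [bohrLambda, zero_pow (show m ≠ 0 by omega)]
    linarith
  have htop : 0 ≤ bohrLambda m k p a (1 / (2 + k)) := by
    rw [bohrLambda_eq ha0 hr0.le (by linarith)]
    have h1 := one_le_bohrPhi (m := m) hk hp ha0 ha1
    have h2 : 0 < 1 - 1 / (2 + k) := by linarith
    exact mul_nonneg (by positivity) (by linarith)
  obtain ⟨R, hR, hR0⟩ := intermediate_value_Icc hr0.le
    (continuous_bohrLambda (m := m) (k := k) (a := a) hp0).continuousOn ⟨hzero.le, htop⟩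
  have hRne : R ≠ 0 := by
    rintro rfl
    exact hzero.ne hR0
  exact ⟨R, ⟨lt_of_le_of_ne hR.1 hRne.symm, by linarith [hR.2]⟩, hR.2.trans hr2, hR0⟩

theorem bohrF_le_bohrPhi {k p : ℝ} {m : ℕ} {h g : ℂ → ℂ} (hk : 0 ≤ k) (hp : 0 < p) (hm : 1 ≤ m)
    (hf : IsHk k h g) (h0 : ‖h 0‖ < 1) {z : ℂ} (hz : ‖z‖ ≤ 1 / 2) :
    bohrF h g k p m z ≤ bohrPhi m k p ‖h 0‖ ‖z‖ := by
  have hzm : z ^ m ∈ ball (0 : ℂ) 1 := by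
    rw [mem_ball_zero_iff, norm_pow]
    exact pow_lt_one₀ (norm_nonneg z) (by linarith) (by omega)
  have h1 := norm_le_schwarz_pick hf.analytic_h hf.norm_h_le h0 hzm
  rw [norm_pow] at h1
  exact add_le_add (Real.rpow_le_rpow (norm_nonneg _) h1 hp.le)
    (bohrE_le hk hf h0 (norm_nonneg z) hz)

/-! ### The extremal function -/

/-- The disk automorphism `z ↦ (a + z) / (1 + a z)`. -/
noncomputable def diskAut (a : ℝ) (z : ℂ) : ℂ := (a + z) / (1 + a * z)

section diskAut

variable {a : ℝ}

theorem one_add_mul_ne_zero_of_mem_ball (ha0 : 0 ≤ a) (ha1 : a < 1) {z : ℂ}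
    (hz : z ∈ ball (0 : ℂ) 1) : (1 : ℂ) + a * z ≠ 0 := by
  intro heq
  have h1 : ‖(a : ℂ) * z‖ = 1 := by
    rw [eq_neg_of_add_eq_zero_right heq, norm_neg, norm_one]
  rw [norm_mul, Complex.norm_real, Real.norm_of_nonneg ha0] at h1
  have hz1 : ‖z‖ < 1 := by simpa using hz
  nlinarith [norm_nonneg z]

theorem differentiableOn_diskAut (ha0 : 0 ≤ a) (ha1 : a < 1) :
    DifferentiableOn ℂ (diskAut a) (ball 0 1) := by
  unfold diskAut
  exact DifferentiableOn.div (by fun_prop) (by fun_prop)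
    fun z hz => one_add_mul_ne_zero_of_mem_ball ha0 ha1 hz

theorem diskAut_zero : diskAut a 0 = a := by
  simp [diskAut]

theorem norm_diskAut_le (ha0 : 0 ≤ a) (ha1 : a < 1) {z : ℂ} (hz : z ∈ ball (0 : ℂ) 1) :
    ‖diskAut a z‖ ≤ 1 := by
  have hz1 : ‖z‖ ≤ 1 := by
    have : ‖z‖ < 1 := by simpa using hz
    exact this.le
  rw [diskAut, norm_div]
  apply div_le_one_of_le₀ _ (norm_nonneg _)
  have h := norm_sub_sq_le_norm_one_sub_sq (α := ((-a : ℝ) : ℂ)) (β := z)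
    (by rw [Complex.norm_real, norm_neg, Real.norm_of_nonneg ha0]; exact ha1.le) hz1
  rw [Complex.conj_ofReal] at h
  have h' := (sq_le_sq₀ (norm_nonneg _) (norm_nonneg _)).1 h
  rwa [Complex.ofReal_neg, sub_neg_eq_add, neg_mul, sub_neg_eq_add, add_comm z] at h'

theorem norm_taylorCoeff_diskAut (ha0 : 0 ≤ a) (ha1 : a < 1) (n : ℕ) :
    ‖taylorCoeff (diskAut a) (n + 1)‖ = (1 - a ^ 2) * a ^ n := by
  set f : ℂ → ℂ := fun z => ((1 - a ^ 2 : ℝ) : ℂ) / (1 + a * z) with hf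
  have hfd : DifferentiableOn ℂ f (ball 0 1) :=
    DifferentiableOn.div (by fun_prop) (by fun_prop)
      fun z hz => one_add_mul_ne_zero_of_mem_ball ha0 ha1 hz
  have hfa := hfd.analyticAt_of_mem_unitBall (mem_ball_self one_pos)
  have h1 : ∀ z ∈ ball (0 : ℂ) 1, diskAut a z - a = z * f z := by
    intro z hz
    have := one_add_mul_ne_zero_of_mem_ball ha0 ha1 hz
    simp only [hf, diskAut]
    field_simp
    push_cast
    ring
  -- The functional equation of a geometric series, giving the recursion for its coefficients.
  have h2 : ∀ z ∈ ball (0 : ℂ) 1, f z = ((1 - a ^ 2 : ℝ) : ℂ) - a * (z * f z) := by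
    intro z hz
    have := one_add_mul_ne_zero_of_mem_ball ha0 ha1 hz
    simp only [hf]
    field_simp
    ring
  rw [← taylorCoeff_sub_const_succ (a : ℂ), taylorCoeff_congr h1, taylorCoeff_id_mul hfa]
  induction n with
  | zero =>
    rw [taylorCoeff_zero]
    simp only [hf, mul_zero, add_zero, div_one, pow_zero, mul_one]
    rw [Complex.norm_real, Real.norm_of_nonneg (by nlinarith)]
  | succ n ih =>
    rw [taylorCoeff_congr h2, taylorCoeff_const_sub_succ, taylorCoeff_const_mul,
      taylorCoeff_id_mul hfa, norm_neg, norm_mul, ih, Complex.norm_real, Real.norm_of_nonneg ha0]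
    ring

theorem nonconstOnDisk_diskAut (ha0 : 0 ≤ a) (ha1 : a < 1) : NonconstOnDisk (diskAut a) := by
  rintro ⟨c, hc⟩
  have h := norm_taylorCoeff_diskAut ha0 ha1 0
  rw [taylorCoeff_congr (g := fun _ => c) hc, taylorCoeff, iteratedDeriv_succ'] at h
  simp at h
  nlinarith

theorem isHk_diskAut {k : ℝ} (hk : 0 ≤ k) (ha0 : 0 ≤ a) (ha1 : a < 1) :
    IsHk k (diskAut a) (fun z => k * (diskAut a z - a)) where
  analytic_h := differentiableOn_diskAut ha0 ha1
  analytic_g := ((differentiableOn_diskAut ha0 ha1).sub_const _).const_mul _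
  g_zero := by simp [diskAut_zero]
  norm_h_le := fun z hz => norm_diskAut_le ha0 ha1 hz
  norm_deriv_le := fun z hz => by
    have hd : DifferentiableAt ℂ (diskAut a) z :=
      (differentiableOn_diskAut ha0 ha1).differentiableAt (isOpen_ball.mem_nhds hz)
    rw [deriv_const_mul _ (hd.sub_const _), deriv_sub_const, norm_mul, Complex.norm_real,
      Real.norm_of_nonneg hk]

theorem bohrF_diskAut {k p r : ℝ} {m : ℕ} (hk : 0 ≤ k) (ha0 : 0 ≤ a) (ha1 : a < 1) (hr0 : 0 ≤ r)
    (hr1 : r < 1) :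
    bohrF (diskAut a) (fun z => k * (diskAut a z - a)) k p m (r : ℂ) = bohrPhi m k p a r := by
  have har0 : 0 ≤ a * r := mul_nonneg ha0 hr0
  have har1 : a * r < 1 := by nlinarith
  have hgn : ∀ n, ‖taylorCoeff (fun z => k * (diskAut a z - a)) (n + 1)‖ =
      k * ((1 - a ^ 2) * a ^ n) := by
    intro n
    rw [taylorCoeff_const_mul, taylorCoeff_sub_const_succ, norm_mul,
      norm_taylorCoeff_diskAut ha0 ha1, Complex.norm_real, Real.norm_of_nonneg hk]
  have hM : ∑' n : ℕ, (1 - a ^ 2) * a ^ n * r ^ (n + 1) = (1 - a ^ 2) * r / (1 - a * r) := by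
    rw [tsum_congr (g := fun n : ℕ => (1 - a ^ 2) * r * (a * r) ^ n) fun n => by ring,
      tsum_mul_left, tsum_geometric_of_lt_one har0 har1]
    ring
  have hQ : ∑' n : ℕ, ((1 - a ^ 2) * a ^ n) ^ 2 * r ^ (2 * (n + 1)) =
      (1 - a ^ 2) ^ 2 * r ^ 2 / (1 - (a * r) ^ 2) := by
    rw [tsum_congr (g := fun n : ℕ => (1 - a ^ 2) ^ 2 * r ^ 2 * ((a * r) ^ 2) ^ n) fun n => by ring,
      tsum_mul_left, tsum_geometric_of_lt_one (by positivity) (by nlinarith)]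
    ring
  have e1 : majorantTail (fun z => k * (diskAut a z - a)) r =
      k * ((1 - a ^ 2) * r / (1 - a * r)) := by
    simp only [majorantTail, hgn]
    rw [← hM, ← tsum_mul_left]
    exact tsum_congr fun n => by ring
  have e2 : normSqR (fun z => k * (diskAut a z - a)) r =
      k ^ 2 * ((1 - a ^ 2) ^ 2 * r ^ 2 / (1 - (a * r) ^ 2)) := by
    simp only [normSqR, hgn]
    rw [← hQ, ← tsum_mul_left]
    exact tsum_congr fun n => by ring
  have e3 : majorantTail (diskAut a) r = (1 - a ^ 2) * r / (1 - a * r) := by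
    simp only [majorantTail, norm_taylorCoeff_diskAut ha0 ha1, hM]
  have e4 : normSqR (diskAut a) r = (1 - a ^ 2) ^ 2 * r ^ 2 / (1 - (a * r) ^ 2) := by
    simp only [normSqR, norm_taylorCoeff_diskAut ha0 ha1, hQ]
  have e5 : ‖diskAut a ((r : ℂ) ^ m)‖ = (r ^ m + a) / (1 + a * r ^ m) := by
    have : diskAut a ((r : ℂ) ^ m) = (((r ^ m + a) / (1 + a * r ^ m) : ℝ) : ℂ) := by
      rw [diskAut]
      push_cast
      ring
    rw [this, Complex.norm_real, Real.norm_of_nonneg (by positivity)]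
  rw [bohrF, bohrPhi, e5, Complex.norm_real, Real.norm_of_nonneg hr0, bohrE, e1, e2, e3, e4,
    diskAut_zero, Complex.norm_real, Real.norm_of_nonneg ha0, ← mul_assoc (cConst k),
    cConst_mul_sq]
  congr 1
  have h1 : 1 - (a * r) ^ 2 = (1 - a * r) * (1 + a * r) := by ring
  have h2 : 1 + a * r ≠ 0 := by positivity
  have h3 : 1 - r ≠ 0 := by linarith
  have h4 : 1 + a ≠ 0 := by positivity
  obtain ⟨e, he⟩ : ∃ e, e = 1 - a * r := ⟨_, rfl⟩
  have h5 : e ≠ 0 := by rw [he]; linarith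
  rw [h1, ← he]
  field_simp
  rw [he]
  ring

end diskAut

/-! ### The Bohr radius and its sharpness -/

theorem theorem3 (k p : ℝ) (hk : k ∈ Set.Icc (0 : ℝ) 1) (hp : p ∈ Set.Ioc (0 : ℝ) 2)
    (m : ℕ) (hm : 1 ≤ m) (h g : ℂ → ℂ) (hf : IsHk k h g) (hne : NonconstOnDisk h)
    (a : ℝ) (ha : a = ‖h 0‖) (q : ℕ) (hq : q = zeroOrder h) :
    ∃ R ∈ Set.Ioo (0 : ℝ) 1,
      bohrLambda m k p a R = 0 ∧
      (∀ r ∈ Set.Ioo (0 : ℝ) 1, bohrLambda m k p a r = 0 → r = R) ∧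
      ((0 < k → ‖taylorCoeff g q‖ ≤ 1 / (2 * k * ‖taylorCoeff h q‖)) →
        ∀ z : ℂ, ‖z‖ ≤ R → bohrF h g k p m z ≤ 1) ∧
      ((k = 0 ∨ k = 1 ∨ R ≤ 1 / 3) →
        (∀ z : ℂ, ‖z‖ ≤ R → bohrF h g k p m z ≤ 1) ∧
        ∃ h₁ g₁ : ℂ → ℂ, IsHk k h₁ g₁ ∧ NonconstOnDisk h₁ ∧ ‖h₁ 0‖ = a ∧
          ∀ r ∈ Set.Ioo R 1, ∃ z : ℂ, ‖z‖ = r ∧ 1 < bohrF h₁ g₁ k p m z) := by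
  have ha0 : 0 ≤ a := ha ▸ norm_nonneg _
  have h0 : ‖h 0‖ < 1 :=
    norm_lt_one_of_nonconst hf.analytic_h hf.norm_h_le hne (mem_ball_self one_pos)
  have ha1 : a < 1 := ha ▸ h0
  obtain ⟨R, hR, hR2, hRz⟩ := exists_bohr_radius (k := k) hm hk.1 hp.1 hp.2 ha0 ha1
  have hmono := strictMonoOn_bohrPhi (m := m) hk.1 hp.1 ha0 ha1
  have hRmem : R ∈ Ico (0 : ℝ) 1 := ⟨hR.1.le, hR.2⟩
  have hΦ : bohrPhi m k p a R = 1 := (bohrLambda_eq_zero_iff ha0 hR.1.le hR.2).1 hRz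
  -- R ≤ 1/2 puts every such z in the range of the estimate, and monotonicity compares Φ(|z|) with
  -- Φ(R) = 1.
  have hmain : ∀ z : ℂ, ‖z‖ ≤ R → bohrF h g k p m z ≤ 1 := by
    intro z hz
    have h1 := bohrF_le_bohrPhi hk.1 hp.1 hm hf h0 (hz.trans hR2)
    rw [← ha] at h1
    rw [← hΦ]
    exact h1.trans (hmono.monotoneOn ⟨norm_nonneg z, hz.trans_lt hR.2⟩ hRmem hz)
  refine ⟨R, hR, hRz, fun r hr hrz => ?_, fun _ => hmain, fun _ => ⟨hmain, diskAut a,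
    fun z => k * (diskAut a z - a), isHk_diskAut hk.1 ha0 ha1, nonconstOnDisk_diskAut ha0 ha1, ?_,
    fun r hr => ⟨(r : ℂ), ?_, ?_⟩⟩⟩
  · exact hmono.injOn ⟨hr.1.le, hr.2⟩ hRmem
      (((bohrLambda_eq_zero_iff ha0 hr.1.le hr.2).1 hrz).trans hΦ.symm)
  · rw [diskAut_zero, Complex.norm_real, Real.norm_of_nonneg ha0]
  · rw [Complex.norm_real, Real.norm_of_nonneg (hR.1.trans hr.1).le]
  · have hr0 : 0 ≤ r := (hR.1.trans hr.1).le
    rw [bohrF_diskAut hk.1 ha0 ha1 hr0 hr.2, ← hΦ]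
    exact hmono hRmem ⟨hr0, hr.2⟩ hr.1
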